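/- **Conventions.** A partition $\alpha=(\alpha_1\ge\alpha_2\ge\dots)$ is identified with its Young diagram with top-aligned columns of lengths $\alpha_1,\alpha_2,\dots$; rows are numbered from the top, and $\overline\alpha$ is the transposed partition. For partitions $\gamma\subseteq\beta$, the skew diagram $\beta\setminus\gamma$ is a horizontal strip if $\beta_i\le\gamma_i+1$ for all $i$, a vertical strip if $\overline\beta\setminus\overline\gamma$ is a horizontal strip, and a rook strip if it is both. An LR-tableau of shape $\beta\setminus\gamma$ is a filling of the cells of $\beta\setminus\gamma$ with positive integers such that the entries weakly increase along rows, strictly increase down columns, and for every column and every $e\ge1$ there are, in this column and the columns to its right, at least as many entries $e$ as entries $e+1$. For an LR-tableau $\Gamma$ let $\gamma^{(e)}$ be the partition whose diagram consists of $\gamma$ and of the cells of $\beta\setminus\gamma$ with entry at most $e$. All LR-tableaux of shape $\beta\setminus\gamma$, of any content $\alpha$ (necessarily $|\alpha|=|\beta|-|\gamma|$), are considered together. **Box order.** Let $\Delta,\Gamma$ be LR-tableaux of the same shape $\beta\setminus\gamma$. We write $\Delta\prec_{\rm box}\Gamma$ if $\Delta$ is obtained from $\Gamma$ either by swapping two entries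 such that the smaller entry winds up in the lower position, or by increasing one entry (by any amount). The relation $\le_{\rm box}$ is the reflexive and transitive closure of $\prec_{\rm box}$ on the LR-tableaux of shape $\beta\setminus\gamma$. **Ext order.** Let $k$ be a field and $N_\alpha=\bigoplus_i k[p]/(p^{\alpha_i})$. Let $\mathcal S$ be the category of embeddings $(A\subset B)$, where $B$ is a finite-dimensional $k[p]$-module on which $p$ acts nilpotently and $A$ is a submodule; a sequence in $\mathcal S$ is short exact if the sequences of the ambient modules and of the submodules (hence of the quotients) are short exact. Let $\mathcal S_\gamma^\beta$ consist of the embeddings with $B\cong N_\beta$ and $B/A\cong N_\gamma$. An embedding $X=(A\subset B)$ in $\mathcal S_\gamma^\beta$ has LR-tableau $LR(X)=\Gamma$ if $B/p^eA\cong N_{\gamma^{(e)}}$ for all $e\ge0$. For embeddings, $X\le_{\rm ext}Y$ means that there are $s\ge0$ and embeddings $H_1,\dots,H_{s+1}$, $U_i,V_i$ $(1\le i\le s)$ in $\mathcal S$ with short exact sequences $0\to U_i\to H_i\to V_i\to0$ such that $X\cong H_1$, $U_i\oplus V_i\cong H_{i+1}$ for $1\le i\le s$, and $Y\cong H_{s+1}$.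 For LR-tableaux $\Delta,\Gamma$ of shape $\beta\setminus\gamma$, $\Delta\le_{\rm ext}\Gamma$ means that there is a sequence $\Delta=\Gamma^{(0)},\Gamma^{(1)},\dots,\Gamma^{(s)}=\Gamma$ of LR-tableaux of shape $\beta\setminus\gamma$ such that for each $1\le i\le s$ there are $X,Y\in\mathcal S_\gamma^\beta$ with $LR(X)=\Gamma^{(i-1)}$, $LR(Y)=\Gamma^{(i)}$ and $X\le_{\rm ext}Y$. **Lemma.** Let $k$ be a field and let $\Delta,\Gamma$ be LR-tableaux of the same shape $\beta\setminus\gamma$, which is a rook strip. If $\Delta\le_{\rm box}\Gamma$, then $\Delta\le_{\rm ext}\Gamma$. -/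

import Mathlib

open Polynomial
open scoped Pointwise

universe u

/-! ### Skew diagrams and Littlewood-Richardson tableaux

A partition is given by its Young diagram. The parts of the partition are the lengths of the
*columns* `α.colLen 0 ≥ α.colLen 1 ≥ ⋯`, and the parts of the transposed partition are the lengths
of the rows. A cell is a pair `(i, j)` of a row index `i` (rows are numbered from the top) and a
column index `j` (columns are numbered from the left), both starting from `0`. -/

namespace YoungDiagram

/-- The cells of the skew diagram `β ∖ γ`. -/
def skewCells (β γ : YoungDiagram) : Finset (ℕ × ℕ) := β.cells \ γ.cells

/-- `β ∖ γ` is a horizontal strip: `β_j ≤ γ_j + 1` for all parts (columns). -/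
def IsHorizontalStrip (β γ : YoungDiagram) : Prop :=
  γ ≤ β ∧ ∀ j, β.colLen j ≤ γ.colLen j + 1

/-- `β ∖ γ` is a vertical strip: the transposed skew diagram is a horizontal strip. -/
def IsVerticalStrip (β γ : YoungDiagram) : Prop :=
  IsHorizontalStrip β.transpose γ.transpose

/-- `β ∖ γ` is a rook strip: both a horizontal and a vertical strip. -/
def IsRookStrip (β γ : YoungDiagram) : Prop :=
  IsHorizontalStrip β γ ∧ IsVerticalStrip β γ

end YoungDiagram

open YoungDiagram in
/-- An LR-tableau of shape `β ∖ γ`. The entries are positive on the skew diagram, and `entry` is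
extended by `0` to all other cells. The lattice condition for `j = 0` says that the numbers of
entries `1, 2, 3, …` decrease weakly; they are the row lengths of the content
(see `LRTableau.existsUnique_content`). -/
@[ext]
structure LRTableau (β γ : YoungDiagram) where
  entry : ℕ → ℕ → ℕ
  le : γ ≤ β
  pos : ∀ i j, (i, j) ∈ skewCells β γ → 0 < entry i j
  zero : ∀ i j, (i, j) ∉ skewCells β γ → entry i j = 0
  row_weak : ∀ i j j', j < j' → (i, j) ∈ skewCells β γ → (i, j') ∈ skewCells β γ →
    entry i j ≤ entry i j'
  col_strict : ∀ i i' j, i < i' → (i, j) ∈ skewCells β γ → (i', j) ∈ skewCells β γ →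
    entry i j < entry i' j
  lattice : ∀ j e, 1 ≤ e →
    ((skewCells β γ).filter (fun c => j ≤ c.2 ∧ entry c.1 c.2 = e + 1)).card ≤
      ((skewCells β γ).filter (fun c => j ≤ c.2 ∧ entry c.1 c.2 = e)).card

namespace LRTableau

open YoungDiagram

variable {β γ : YoungDiagram}

/-- The number of entries equal to `e`. -/
def count (T : LRTableau β γ) (e : ℕ) : ℕ :=
  ((skewCells β γ).filter (fun c => T.entry c.1 c.2 = e)).card

/-- `T` has content `α`: there are `α.rowLen 0` entries `1`, `α.rowLen 1` entries `2`, etc. -/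
def HasContent (T : LRTableau β γ) (α : YoungDiagram) : Prop :=
  ∀ e, T.count (e + 1) = α.rowLen e

/-- The diagram `γ^(e)`, consisting of `γ` and of the cells of `β ∖ γ` with an entry at most `e`. -/
def stage (T : LRTableau β γ) (e : ℕ) : YoungDiagram where
  cells := β.cells.filter (fun c => T.entry c.1 c.2 ≤ e)
  isLowerSet := by
    rintro ⟨i', j'⟩ ⟨i, j⟩ ⟨hi, hj⟩ h
    simp only [Finset.coe_filter, Set.mem_ofPred_eq, mem_cells] at h ⊢
    simp only at hi hj
    obtain ⟨hβ, he⟩ := h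
    have h1 : (i, j') ∈ β := β.up_left_mem hi le_rfl hβ
    have h2 : (i, j) ∈ β := β.up_left_mem le_rfl hj h1
    refine ⟨h2, ?_⟩
    by_cases hs : (i, j) ∈ skewCells β γ
    · have hn : (i, j) ∉ γ := by simpa [skewCells, h2] using hs
      have hn1 : (i, j') ∉ γ := fun h => hn (γ.up_left_mem le_rfl hj h)
      have hn2 : (i', j') ∉ γ := fun h => hn1 (γ.up_left_mem hi le_rfl h)
      have s1 : (i, j') ∈ skewCells β γ := by simp [skewCells, h1, hn1]
      have s2 : (i', j') ∈ skewCells β γ := by simp [skewCells, hβ, hn2]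
      have a : T.entry i j ≤ T.entry i j' := by
        rcases hj.lt_or_eq with h | h
        · exact T.row_weak _ _ _ h hs s1
        · rw [h]
      have b : T.entry i j' ≤ T.entry i' j' := by
        rcases hi.lt_or_eq with h | h
        · exact (T.col_strict _ _ _ h s1 s2).le
        · rw [h]
      omega
    · rw [T.zero _ _ hs]
      exact Nat.zero_le _

/-- Every LR-tableau of shape `β ∖ γ` has a unique content `α`, and `|α| = |β| - |γ|`. -/
theorem existsUnique_content (T : LRTableau β γ) :
    ∃! α : YoungDiagram, T.HasContent α ∧ α.card + γ.card = β.card := by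
  have anti : Antitone (fun e => T.count (e + 1)) := by
    refine antitone_nat_of_succ_le fun e => ?_
    have := T.lattice 0 (e + 1) (by omega)
    simpa [count] using this
  have hle : ∀ e, T.count e ≤ (skewCells β γ).card := fun e => Finset.card_filter_le _ _
  obtain ⟨M, hM⟩ : ∃ M, ∀ c ∈ skewCells β γ, T.entry c.1 c.2 ≤ M :=
    ⟨(skewCells β γ).sup (fun c => T.entry c.1 c.2), fun c hc =>
      Finset.le_sup (f := fun c : ℕ × ℕ => T.entry c.1 c.2) hc⟩
  have h0 : ∀ e, M ≤ e → T.count (e + 1) = 0 := by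
    intro e he
    rw [count, Finset.card_eq_zero, Finset.filter_eq_empty_iff]
    intro c hc
    have := hM c hc
    omega
  let α : YoungDiagram :=
    { cells := (Finset.range M ×ˢ Finset.range (skewCells β γ).card).filter
        (fun c => c.2 < T.count (c.1 + 1))
      isLowerSet := by
        rintro ⟨i', j'⟩ ⟨i, j⟩ ⟨hi, hj⟩ h
        simp only [Finset.coe_filter, Set.mem_ofPred_eq, Finset.mem_product,
          Finset.mem_range] at h ⊢
        simp only at hi hj
        have := anti hi
        simp only at this
        omega }
  have hmem : ∀ i j, (i, j) ∈ α ↔ j < T.count (i + 1) := by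
    intro i j
    rw [← mem_cells]
    simp only [α, Finset.mem_filter, Finset.mem_product, Finset.mem_range]
    refine ⟨fun h => h.2, fun h => ⟨⟨?_, h.trans_le (hle _)⟩, h⟩⟩
    by_contra hn
    rw [h0 i (by omega)] at h
    omega
  have hα : T.HasContent α := by
    intro e
    refine eq_of_forall_lt_iff fun j => ?_
    rw [← hmem, mem_iff_lt_rowLen]
  refine ⟨α, ⟨hα, ?_⟩, ?_⟩
  · have h1 : (skewCells β γ).card + γ.card = β.card :=
      Finset.card_sdiff_add_card_eq_card (cells_subset_iff.2 T.le)
    rw [← h1]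
    congr 1
    have h2 : (skewCells β γ).card = ∑ e ∈ Finset.range M, T.count (e + 1) := by
      rw [Finset.card_eq_sum_card_fiberwise (f := fun c => T.entry c.1 c.2 - 1)
        (t := Finset.range M)]
      · refine Finset.sum_congr rfl fun e _ => congrArg Finset.card ?_
        refine Finset.filter_congr fun c hc => ?_
        have := T.pos c.1 c.2 hc
        omega
      · intro c hc
        have := T.pos c.1 c.2 hc
        have := hM c hc
        simp only [Finset.coe_range, Set.mem_Iio]
        omega
    have h3 : α.card = ∑ e ∈ Finset.range M, (α.row e).card := by
      rw [YoungDiagram.card, Finset.card_eq_sum_card_fiberwise (f := Prod.fst)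
        (t := Finset.range M)]
      · rfl
      · intro c hc
        have : c ∈ α.cells := hc
        simp only [α, Finset.mem_filter, Finset.mem_product, Finset.mem_range] at this
        simpa using this.1.1
    rw [h2, h3]
    refine Finset.sum_congr rfl fun e _ => ?_
    rw [hα e, rowLen_eq_card]
  · rintro α' ⟨h, -⟩
    ext ⟨i, j⟩
    rw [mem_cells, mem_cells, hmem, h i, mem_iff_lt_rowLen]

/-- `Δ` is obtained from `Γ` by swapping two entries, such that the smaller entry winds up in the
lower position: `(i, j)` is the upper cell and `(i', j')` is the lower one. -/
def IsSwap (Δ Γ : LRTableau β γ) : Prop :=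
  ∃ i j i' j', (i, j) ∈ skewCells β γ ∧ (i', j') ∈ skewCells β γ ∧ i < i' ∧
    Γ.entry i j < Γ.entry i' j' ∧
    Δ.entry i j = Γ.entry i' j' ∧ Δ.entry i' j' = Γ.entry i j ∧
    ∀ a b, (a, b) ≠ (i, j) → (a, b) ≠ (i', j') → Δ.entry a b = Γ.entry a b

/-- `Δ` is obtained from `Γ` by increasing one entry (by an arbitrary amount). -/
def IsIncrease (Δ Γ : LRTableau β γ) : Prop :=
  ∃ i j, (i, j) ∈ skewCells β γ ∧ Γ.entry i j < Δ.entry i j ∧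
    ∀ a b, (a, b) ≠ (i, j) → Δ.entry a b = Γ.entry a b

/-- `Δ` is obtained from `Γ` by a decreasing box move. -/
def BoxMove (Δ Γ : LRTableau β γ) : Prop := IsSwap Δ Γ ∨ IsIncrease Δ Γ

/-- The box order `Δ ≤_box Γ`, generated by the decreasing box moves. -/
def BoxLE (Δ Γ : LRTableau β γ) : Prop := Relation.ReflTransGen BoxMove Δ Γ

end LRTableau

/-! ### Invariant subspaces of nilpotent linear operators -/

/-- The nilpotent operator `N_α = ⨁_j k[X] / (X ^ α_j)`, as a `k[X]`-module;
`j` runs over the columns of the diagram `α`. -/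
abbrev NilpModule (k : Type u) [Field k] (α : YoungDiagram) : Type u :=
  (j : Fin (α.rowLen 0)) → k[X] ⧸ Ideal.span {(X : k[X]) ^ α.colLen j}

/-- An embedding `(A ⊂ B)`: a nilpotent finite-dimensional `k[X]`-module `B` with a submodule `A`.
A `k[X]`-module on which `X` acts nilpotently is finite-dimensional over `k` if and only if it is
finitely generated over `k[X]`. -/
structure NilpEmbedding (k : Type u) [Field k] : Type (u + 1) where
  B : Type u
  [addCommGroup : AddCommGroup B]
  [module : Module k[X] B]
  [finite : Module.Finite k[X] B]
  nilpotent : ∃ n : ℕ, ∀ b : B, (X : k[X]) ^ n • b = 0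
  A : Submodule k[X] B

namespace NilpEmbedding

attribute [instance] NilpEmbedding.addCommGroup NilpEmbedding.module NilpEmbedding.finite

variable {k : Type u} [Field k]

/-- Isomorphism of embeddings. -/
def Iso (E F : NilpEmbedding k) : Prop :=
  ∃ f : E.B ≃ₗ[k[X]] F.B, E.A.map (f : E.B →ₗ[k[X]] F.B) = F.A

/-- The direct sum of two embeddings. -/
noncomputable def directSum (E F : NilpEmbedding k) : NilpEmbedding k where
  B := E.B × F.B
  nilpotent := by
    obtain ⟨m, hm⟩ := E.nilpotent
    obtain ⟨n, hn⟩ := F.nilpotent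
    refine ⟨m + n, fun b => Prod.ext ?_ ?_⟩
    · rw [Prod.smul_fst, Nat.add_comm, pow_add, mul_smul, hm, smul_zero, Prod.fst_zero]
    · rw [Prod.smul_snd, pow_add, mul_smul, hn, smul_zero, Prod.snd_zero]
  A := E.A.prod F.A

/-- There is a short exact sequence of embeddings `0 → U → H → V → 0`: two composable morphisms
of embeddings such that the sequences of the ambient modules and of the submodules are exact.
(The sequence of the quotient modules is then exact as well.) -/
def HasShortExact (U H V : NilpEmbedding k) : Prop :=
  ∃ (f : U.B →ₗ[k[X]] H.B) (g : H.B →ₗ[k[X]] V.B)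
    (hf : ∀ x ∈ U.A, f x ∈ H.A) (hg : ∀ x ∈ H.A, g x ∈ V.A),
    (Function.Injective f ∧ Function.Exact f g ∧ Function.Surjective g) ∧
    (Function.Injective (f.restrict hf) ∧ Function.Exact (f.restrict hf) (g.restrict hg) ∧
      Function.Surjective (g.restrict hg))

/-- The relation `E ≤_ext F`. -/
def ExtLE (E F : NilpEmbedding k) : Prop :=
  ∃ (s : ℕ) (H U V : ℕ → NilpEmbedding k),
    Iso E (H 0) ∧
    (∀ i < s, HasShortExact (U i) (H i) (V i) ∧ Iso (directSum (U i) (V i)) (H (i + 1))) ∧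
    Iso F (H s)

/-- The embedding `(A ⊂ B)` satisfies `B ≅ N_β` and `B / A ≅ N_γ`
(so that `A` has dimension `|β| - |γ|`). -/
def HasShape (E : NilpEmbedding k) (β γ : YoungDiagram) : Prop :=
  Nonempty (E.B ≃ₗ[k[X]] NilpModule k β) ∧ Nonempty ((E.B ⧸ E.A) ≃ₗ[k[X]] NilpModule k γ)

/-- `T` is the LR-tableau of the embedding `(A ⊂ B)`: `B / p^e A ≅ N_{γ^(e)}` for all `e`. -/
def HasTableau {β γ : YoungDiagram} (E : NilpEmbedding k) (T : LRTableau β γ) : Prop :=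
  ∀ e : ℕ, Nonempty ((E.B ⧸ ((X : k[X]) ^ e • E.A)) ≃ₗ[k[X]] NilpModule k (T.stage e))

end NilpEmbedding

/-- The relation `S ≤_ext T` of LR-tableaux of shape `β ∖ γ`, over the field `k`: there is a finite
sequence of LR-tableaux from `S` to `T` such that any two consecutive ones are the tableaux of two
embeddings which are comparable with respect to `≤_ext`. -/
def LRTableau.ExtLE (k : Type u) [Field k] {β γ : YoungDiagram} (S T : LRTableau β γ) : Prop :=
  Relation.ReflTransGen
    (fun S T : LRTableau β γ => ∃ E F : NilpEmbedding k,
      E.HasShape β γ ∧ F.HasShape β γ ∧ E.HasTableau S ∧ F.HasTableau T ∧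
        NilpEmbedding.ExtLE E F) S T

/-! ### Predecessor maps and chains -/

/-! Both orders on tableaux are generated step by step, and the ext order may change embeddings
between steps. So it suffices to realise one box move from `Γ` to `Δ` by a single short exact
sequence.

On a horizontal strip a tableau is a function `T` on the columns that carry a cell, and on a rook
strip these columns have distinct lengths. By Hall's theorem the lattice condition matches every
entry `e + 1` with an entry `e` further right, hence in a shorter column. The columns thus fall into
chains with entries `1, …, m` and increasing lengths. Each chain yields one element of `N_β`, the
sum of `X ^ (β_t - T t)` times the generator of column `t`. These elements generate a submodule `A'`
with tableau `Γ` (`hasTableau_levelSpan`).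

A move raises the entry of some column `q` to `v`. The chains can be chosen so that a column `p`
with entry `v - 1`, shorter than `q`, lies in another chain than `q` (`exists_isMoveLabel_increase`,
`exists_isMoveLabel_swap`). Adding `X ^ (β_q - v)` times the generator of `q` to the element of the
chain of `p` gives a submodule `A`. Its tableau is `Δ`, by the unitriangular criterion
`hasTableau_embedding`.

Modulo the summands of `N_β` in the chain of `q`, the submodules `A` and `A'` agree, and they meet
these summands in the same submodule. Projecting these summands away gives a short exact sequence
with middle term `(A ⊂ N_β)` whose end terms add up to `(A' ⊂ N_β)` (`extLE_of_idempotent`,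
`extLE_levelSpan`). -/

/-- If, to the right of every position, there are at least as many elements of `F` as of `G`, then
`G` can be matched injectively to elements of `F` further to the right. -/
theorem exists_injOn_lt_of_card_filter_le (F G : Finset ℕ) (hd : Disjoint F G)
    (h : ∀ j, (G.filter (j ≤ ·)).card ≤ (F.filter (j ≤ ·)).card) :
    ∃ f : ℕ → ℕ, (∀ g ∈ G, f g ∈ F ∧ g < f g) ∧ Set.InjOn f G := by
  classical
  obtain ⟨f, hf, hm⟩ := (Finset.all_card_le_biUnion_card_iff_exists_injective
    (fun g : G => F.filter (fun t => g.1 < t))).1 (by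
      intro A
      rcases A.eq_empty_or_nonempty with rfl | hA
      · simp
      -- Hall's condition: the candidates of the leftmost element `m` of `A` alone are numerous
      -- enough. Disjointness turns `m ≤ x` into `m < x`.
      obtain ⟨m, hm, hmin⟩ := A.exists_min_image (fun g => g.1) hA
      calc A.card = (A.map (Function.Embedding.subtype _)).card := (Finset.card_map _).symm
        _ ≤ (G.filter (m.1 ≤ ·)).card := by
          refine Finset.card_le_card fun x hx => ?_
          obtain ⟨y, hy, rfl⟩ := Finset.mem_map.1 hx
          exact Finset.mem_filter.2 ⟨y.2, hmin y hy⟩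
        _ ≤ (F.filter (m.1 ≤ ·)).card := h _
        _ ≤ _ := by
          refine Finset.card_le_card fun x hx => ?_
          obtain ⟨hx, hmx⟩ := Finset.mem_filter.1 hx
          refine Finset.mem_biUnion.2 ⟨m, hm, Finset.mem_filter.2 ⟨hx, lt_of_le_of_ne hmx ?_⟩⟩
          rintro rfl
          exact Finset.disjoint_left.1 hd hx m.2)
  refine ⟨fun g => if hg : g ∈ G then f ⟨g, hg⟩ else 0, fun g hg => ?_, fun a ha b hb hab => ?_⟩
  · have := Finset.mem_filter.1 (hm ⟨g, hg⟩)
    simpa [hg] using this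
  · have ha' : a ∈ G := ha
    have hb' : b ∈ G := hb
    simp only [ha', hb', dif_pos] at hab
    simpa using hf hab

/-- An injective map which sends every element of `S` of a level `e + 1 ≥ 2` to a larger element
of level `e`. -/
structure IsPredMap (S : Finset ℕ) (T : ℕ → ℕ) (f : ℕ → ℕ) : Prop where
  mem : ∀ s ∈ S, 1 < T s → f s ∈ S
  level : ∀ s ∈ S, 1 < T s → T (f s) + 1 = T s
  lt : ∀ s ∈ S, 1 < T s → s < f s
  inj : ∀ s ∈ S, ∀ t ∈ S, 1 < T s → 1 < T t → f s = f t → s = t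

/-- A decomposition of `S` into chains, labelled by `κ`: every chain has at most one element on
each level `1, 2, …`, it has no gaps, and `b` increases with the level. -/
structure IsChainLabel (S : Finset ℕ) (b T : ℕ → ℕ) (κ : ℕ → ℕ) : Prop where
  inj : ∀ s ∈ S, ∀ t ∈ S, κ s = κ t → T s = T t → s = t
  lt : ∀ s ∈ S, ∀ t ∈ S, κ s = κ t → T s < T t → b s < b t
  pred : ∀ s ∈ S, 1 < T s → ∃ t ∈ S, κ t = κ s ∧ T t + 1 = T s

/-- The matchings for the individual pairs of consecutive levels are glued; images of different
levels have different levels, so injectivity survives. -/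
theorem exists_isPredMap (S : Finset ℕ) (T : ℕ → ℕ)
    (h : ∀ j e, 1 ≤ e → (S.filter (fun s => j ≤ s ∧ T s = e + 1)).card ≤
      (S.filter (fun s => j ≤ s ∧ T s = e)).card) :
    ∃ f, IsPredMap S T f := by
  have key : ∀ e, ∃ f : ℕ → ℕ, 1 < e → (∀ g ∈ S.filter (fun s => T s = e),
      f g ∈ S.filter (fun s => T s + 1 = e) ∧ g < f g) ∧
      Set.InjOn f (S.filter (fun s => T s = e)) := by
    intro e
    by_cases he : 1 < e
    · obtain ⟨f, hf⟩ := exists_injOn_lt_of_card_filter_le (S.filter (fun s => T s + 1 = e))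
        (S.filter (fun s => T s = e)) (Finset.disjoint_filter.2 fun x _ h1 h2 => by omega) (by
          intro j
          have := h j (e - 1) (by omega)
          rw [Finset.filter_filter, Finset.filter_filter]
          convert this using 2 <;> exact Finset.filter_congr (fun s _ => by omega))
      exact ⟨f, fun _ => hf⟩
    · exact ⟨id, fun h => absurd h he⟩
  choose f hf using key
  refine ⟨fun s => f (T s) s, ⟨?_, ?_, ?_, ?_⟩⟩
  · intro s hs h1
    exact (Finset.mem_filter.1 ((hf _ h1).1 s (Finset.mem_filter.2 ⟨hs, rfl⟩)).1).1
  · intro s hs h1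
    exact (Finset.mem_filter.1 ((hf _ h1).1 s (Finset.mem_filter.2 ⟨hs, rfl⟩)).1).2
  · intro s hs h1
    exact ((hf _ h1).1 s (Finset.mem_filter.2 ⟨hs, rfl⟩)).2
  · intro s hs t ht h1 h2 hst
    have e1 := (Finset.mem_filter.1 ((hf _ h1).1 s (Finset.mem_filter.2 ⟨hs, rfl⟩)).1).2
    have e2 := (Finset.mem_filter.1 ((hf _ h2).1 t (Finset.mem_filter.2 ⟨ht, rfl⟩)).1).2
    have e3 : T s = T t := by
      have e3 : f (T s) s = f (T t) t := hst
      rw [e3] at e1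
      omega
    refine (hf _ h2).2 ?_ ?_ (by simpa [e3] using hst)
    · simpa using ⟨hs, e3⟩
    · simpa using ht

namespace IsPredMap

variable {S : Finset ℕ} {T f : ℕ → ℕ}

/-- The chain label of a predecessor map: the element of level `1` below a given element. -/
def label (T f : ℕ → ℕ) (s : ℕ) : ℕ := f^[T s - 1] s

theorem label_apply (h : IsPredMap S T f) {s : ℕ} (hs : s ∈ S) (h1 : 1 < T s) :
    label T f (f s) = label T f s := by
  have := h.level s hs h1
  unfold label
  rw [← Function.iterate_succ_apply]
  congr 2
  omega

/-- Both elements descend to level `1` in the same number of steps, and each step is injective. -/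
theorem eq_of_label_eq (h : IsPredMap S T f) : ∀ (n s t : ℕ), s ∈ S → t ∈ S → T s = n → T t = n →
    label T f s = label T f t → s = t := by
  intro n
  induction n with
  | zero => intro s t _ _ h1 h2 h3; simpa [label, h1, h2] using h3
  | succ n ih =>
    intro s t hs ht h1 h2 h3
    by_cases hn : n = 0
    · subst hn
      simpa [label, h1, h2] using h3
    · have hs1 : 1 < T s := by omega
      have ht1 : 1 < T t := by omega
      have := h.level s hs hs1
      have := h.level t ht ht1
      refine h.inj s hs t ht hs1 ht1 (ih _ _ (h.mem s hs hs1) (h.mem t ht ht1) (by omega)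
        (by omega) ?_)
      rw [h.label_apply hs hs1, h.label_apply ht ht1, h3]

/-- The descent from `t` to level `1` passes through `s`, and every step goes to the right. -/
theorem lt_of_label_eq (h : IsPredMap S T f) (hpos : ∀ s ∈ S, 0 < T s) :
    ∀ (n s t : ℕ), s ∈ S → t ∈ S → T t = n → T s < T t →
      label T f s = label T f t → t < s := by
  intro n
  induction n with
  | zero => intro s t _ _ h1 h2 h3; omega
  | succ n ih =>
    intro s t hs ht h1 h2 h3
    have := hpos s hs
    have ht1 : 1 < T t := by omega
    have hl := h.level t ht ht1
    have hlt := h.lt t ht ht1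
    have hm := h.mem t ht ht1
    rcases Nat.lt_or_ge (T s) n with hc | hc
    · exact hlt.trans (ih s (f t) hs hm (by omega) (by omega)
        (by rw [h3, h.label_apply ht ht1]))
    · have : s = f t := h.eq_of_label_eq n s (f t) hs hm (by omega) (by omega)
        (by rw [h3, h.label_apply ht ht1])
      omega

theorem isChainLabel (h : IsPredMap S T f) (hpos : ∀ s ∈ S, 0 < T s) {b : ℕ → ℕ}
    (hb : ∀ s ∈ S, ∀ t ∈ S, t < s → b s < b t) : IsChainLabel S b T (label T f) where
  inj s hs t ht h1 h2 := h.eq_of_label_eq _ s t hs ht h2 rfl h1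
  lt s hs t ht h1 h2 := hb s hs t ht (h.lt_of_label_eq hpos _ s t hs ht rfl h2 h1)
  pred s hs h1 := ⟨f s, h.mem s hs h1, h.label_apply hs h1, h.level s hs h1⟩

end IsPredMap

namespace IsChainLabel

variable {S : Finset ℕ} {b T κ : ℕ → ℕ}

/-- A gapless chain with strictly increasing natural numbers `b` grows by at least one per level.
This is the source of all exponent estimates below. -/
theorem add_sub_le (h : IsChainLabel S b T κ) (hpos : ∀ s ∈ S, 0 < T s) :
    ∀ (n s t : ℕ), s ∈ S → t ∈ S → T t = n → κ s = κ t → T s ≤ T t →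
      b s + (T t - T s) ≤ b t := by
  intro n
  induction n with
  | zero =>
    intro s t _ ht h1 h2 h3
    have := hpos t ht
    omega
  | succ n ih =>
    intro s t hs ht h1 h2 h3
    rcases h3.eq_or_lt with h3 | h3
    · have := h.inj s hs t ht h2 h3
      subst this
      omega
    · have := hpos s hs
      obtain ⟨p, hp, hp1, hp2⟩ := h.pred t ht (by omega)
      have := ih s p hs hp (by omega) (by rw [h2, hp1]) (by omega)
      have := h.lt p hp t ht hp1 (by omega)
      omega

/-- Applied to column lengths, this keeps the subtractions in the exponents of `chainElt` from being
truncated. -/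
theorem level_le (h : IsChainLabel S b T κ)
    (hb : ∀ s ∈ S, 0 < b s) : ∀ (n s : ℕ), s ∈ S → T s = n → T s ≤ b s := by
  intro n
  induction n with
  | zero => intro s _ hs; omega
  | succ n ih =>
    intro s hs hn
    by_cases h1 : 1 < T s
    · obtain ⟨p, hp, hp1, hp2⟩ := h.pred s hs h1
      have := ih p hp (by omega)
      have := h.lt p hp s hs hp1 (by omega)
      omega
    · have := hb s hs
      omega

/-- A chain with an element of level `m` has elements on all levels `1, …, m`. -/
theorem exists_level (h : IsChainLabel S b T κ) : ∀ (m n s : ℕ), s ∈ S → T s = m → 1 ≤ n →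
    n ≤ m → ∃ t ∈ S, κ t = κ s ∧ T t = n := by
  intro m
  induction m with
  | zero => intro n s _ _ h1 h2; omega
  | succ m ih =>
    intro n s hs hm h1 h2
    rcases h2.eq_or_lt with h2 | h2
    · exact ⟨s, hs, rfl, by omega⟩
    · obtain ⟨p, hp, hp1, hp2⟩ := h.pred s hs (by omega)
      obtain ⟨t, ht, ht1, ht2⟩ := ih n p hp (by omega) h1 (by omega)
      exact ⟨t, ht, ht1.trans hp1, ht2⟩

end IsChainLabel

/-- A chain decomposition for the levels `T` which is adapted to a move that puts the element `q`
of a level `u` onto the level `v > u`, right after the last element `p` of a level `< v` of another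
chain. -/
structure IsMoveLabel (S : Finset ℕ) (b T κ : ℕ → ℕ) (q p v : ℕ) : Prop where
  chain : IsChainLabel S b T κ
  q_mem : q ∈ S
  p_mem : p ∈ S
  q_lt : T q < v
  p_level : T p + 1 = v
  b_lt : b p < b q
  ne : κ p ≠ κ q

/-- A chain decomposition adapted to the increase of the level of `q` from `T q` to `v`. -/
theorem exists_isMoveLabel_increase {S : Finset ℕ} {b T T' f f' : ℕ → ℕ} {q : ℕ}
    (hpos : ∀ s ∈ S, 0 < T s) (hb : ∀ s ∈ S, ∀ t ∈ S, t < s → b s < b t)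
    (hf : IsPredMap S T f) (hf' : IsPredMap S T' f') (hq : q ∈ S) (hlt : T q < T' q)
    (hT : ∀ s, s ≠ q → T' s = T s) :
    ∃ κ p, IsMoveLabel S b T κ q p (T' q) ∧ (∀ s ∈ S, κ s = κ p → T s < T' q) ∧
      (∀ s ∈ S, κ s = κ q → T s ≤ T q) := by
  classical
  set u := T q with hu
  set v := T' q with hv
  have hu0 : 0 < u := hpos q hq
  -- Using `f'` on level `u + 1` makes `q` the end of its chain, since `q` has level `v` for `T'`.
  -- Using it on level `v` makes `f' q` an end, since by injectivity only `q` is sent there, and `q`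
  -- does not have level `v` for `T`.
  let g : ℕ → ℕ := fun s => if T s = u + 1 ∨ T s = v then f' s else f s
  have hne : ∀ s ∈ S, T s = u + 1 ∨ T s = v → s ≠ q := by
    rintro s _ h rfl
    omega
  have hl' : ∀ s ∈ S, T s = u + 1 ∨ T s = v → T (f' s) + 1 = T s ∧ f' s ≠ q := by
    intro s hs h
    have h1 := hT s (hne s hs h)
    have h2 := hf'.level s hs (by omega)
    have h3 : f' s ≠ q := by
      intro h3
      rw [h3] at h2
      omega
    rw [hT _ h3] at h2
    exact ⟨by omega, h3⟩
  have hg : IsPredMap S T g := by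
    refine ⟨fun s hs h1 => ?_, fun s hs h1 => ?_, fun s hs h1 => ?_, fun s hs t ht h1 h2 h3 => ?_⟩
    · by_cases h : T s = u + 1 ∨ T s = v
      · simp only [g, if_pos h]
        exact hf'.mem s hs (by rw [hT s (hne s hs h)]; exact h1)
      · simp only [g, if_neg h]
        exact hf.mem s hs h1
    · by_cases h : T s = u + 1 ∨ T s = v
      · simp only [g, if_pos h]
        exact (hl' s hs h).1
      · simp only [g, if_neg h]
        exact hf.level s hs h1
    · by_cases h : T s = u + 1 ∨ T s = v
      · simp only [g, if_pos h]
        exact hf'.lt s hs (by rw [hT s (hne s hs h)]; exact h1)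
      · simp only [g, if_neg h]
        exact hf.lt s hs h1
    · have lev : ∀ s ∈ S, 1 < T s → T (g s) + 1 = T s := by
        intro s hs h1
        by_cases h : T s = u + 1 ∨ T s = v
        · simp only [g, if_pos h]
          exact (hl' s hs h).1
        · simp only [g, if_neg h]
          exact hf.level s hs h1
      have e : T s = T t := by
        rw [← lev s hs h1, ← lev t ht h2, h3]
      by_cases h : T s = u + 1 ∨ T s = v
      · have h' : T t = u + 1 ∨ T t = v := by rwa [← e]
        simp only [g, if_pos h, if_pos h'] at h3
        exact hf'.inj s hs t ht (by rw [hT s (hne s hs h)]; exact h1)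
          (by rw [hT t (hne t ht h')]; exact h2) h3
      · have h' : ¬ (T t = u + 1 ∨ T t = v) := by rwa [← e]
        simp only [g, if_neg h, if_neg h'] at h3
        exact hf.inj s hs t ht h1 h2 h3
  have hc := hg.isChainLabel hpos hb
  have hv1 : 1 < T' q := by omega
  have hpS := hf'.mem q hq hv1
  have hpl := hf'.level q hq hv1
  have hplt := hf'.lt q hq hv1
  rw [hT _ (by omega)] at hpl
  have hqend : ∀ s ∈ S, IsPredMap.label T g s = IsPredMap.label T g q → T s ≤ u := by
    intro s hs h
    by_contra hn
    obtain ⟨t, ht, ht1, ht2⟩ := hc.exists_level _ (u + 1) s hs rfl (by omega) (by omega)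
    have h1 : 1 < T t := by omega
    have hgq : g t = q := hc.inj _ (hg.mem t ht h1) q hq
      (by rw [hg.label_apply ht h1, ht1, h]) (by have := hg.level t ht h1; omega)
    have hor : T t = u + 1 ∨ T t = v := Or.inl ht2
    simp only [g, if_pos hor] at hgq
    exact (hl' t ht hor).2 hgq
  refine ⟨_, f' q, ⟨hc, hq, hpS, hlt, hpl, hb _ hpS _ hq hplt, ?_⟩, ?_, hqend⟩
  · intro h
    have h1 := hqend _ hpS h
    have := hc.inj _ hpS q hq h (by omega)
    omega
  · intro s hs h
    by_contra hn
    obtain ⟨t, ht, ht1, ht2⟩ := hc.exists_level _ v s hs rfl (by omega) (by omega)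
    have h1 : 1 < T t := by omega
    have hgq : g t = f' q := hc.inj _ (hg.mem t ht h1) _ hpS
      (by rw [hg.label_apply ht h1, ht1, h]) (by have := hg.level t ht h1; omega)
    have hor : T t = u + 1 ∨ T t = v := Or.inr ht2
    simp only [g, if_pos hor] at hgq
    refine hne t ht hor (hf'.inj t ht q hq ?_ hv1 hgq)
    rw [hT t (hne t ht hor)]
    exact h1

/-- A chain decomposition adapted to the exchange of the levels of `j` and `q`. -/
theorem exists_isMoveLabel_swap {S : Finset ℕ} {b T T' f f' : ℕ → ℕ} {q j : ℕ}
    (hpos : ∀ s ∈ S, 0 < T s) (hb : ∀ s ∈ S, ∀ t ∈ S, t < s → b s < b t)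
    (hf : IsPredMap S T f) (hf' : IsPredMap S T' f') (hq : q ∈ S) (hj : j ∈ S) (hjq : j < q)
    (hlt : T q < T j) (hT : ∀ s, T' s = T (Equiv.swap q j s)) :
    ∃ κ p, IsMoveLabel S b T κ q p (T j) ∧ κ j = κ p ∧
      (∀ s ∈ S, κ s = κ q → T q < T s → b j < b s) := by
  classical
  set u := T q with hu
  set v := T j with hv
  set σ := Equiv.swap q j with hσ
  have hσq : σ q = j := Equiv.swap_apply_left q j
  have hσj : σ j = q := Equiv.swap_apply_right q j
  have hσσ : ∀ s, σ (σ s) = s := Equiv.swap_apply_self q j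
  have hσn : ∀ s, s ≠ q → s ≠ j → σ s = s := fun s => Equiv.swap_apply_of_ne_of_ne
  have hσS : ∀ s ∈ S, σ s ∈ S := by
    intro s hs
    by_cases h1 : s = q
    · rwa [h1, hσq]
    · by_cases h2 : s = j
      · rwa [h2, hσj]
      · rwa [hσn s h1 h2]
  have hT2 : ∀ s, T' (σ s) = T s := fun s => by rw [hT, hσσ]
  have hu0 : 0 < u := hpos q hq
  -- Conjugation by the exchange turns `f'` into a map with the right levels for `T`; on the levels
  -- `u + 1` and `v` it also still goes to the right.
  let g : ℕ → ℕ := fun s => if T s = u + 1 ∨ T s = v then σ (f' (σ s)) else f s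
  have hl' : ∀ s ∈ S, 1 < T s → T (σ (f' (σ s))) + 1 = T s := by
    intro s hs h
    rw [← hT, ← hT2 s]
    exact hf'.level _ (hσS s hs) (by rwa [hT2])
  have hlt' : ∀ s ∈ S, T s = u + 1 ∨ T s = v → s < σ (f' (σ s)) := by
    intro s hs h
    have hsq : s ≠ q := by rintro rfl; omega
    have h1 : 1 < T s := by omega
    have h2 := hf'.lt _ (hσS s hs) (by rwa [hT2])
    have h3 := hl' s hs h1
    by_cases hsj : s = j
    · subst hsj
      rw [hσj] at h2 ⊢
      rw [hσn _ (by omega) (by omega)]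
      omega
    · rw [hσn s hsq hsj] at h2 h3 ⊢
      by_cases h4 : f' s = j
      · rw [h4, hσj]
        omega
      · by_cases h5 : f' s = q
        · rw [h5, hσq] at h3
          omega
        · rwa [hσn _ h5 h4]
  have lev : ∀ s ∈ S, 1 < T s → T (g s) + 1 = T s := by
    intro s hs h1
    by_cases h : T s = u + 1 ∨ T s = v
    · simp only [g, if_pos h]
      exact hl' s hs h1
    · simp only [g, if_neg h]
      exact hf.level s hs h1
  have hg : IsPredMap S T g := by
    refine ⟨fun s hs h1 => ?_, lev, fun s hs h1 => ?_, fun s hs t ht h1 h2 h3 => ?_⟩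
    · by_cases h : T s = u + 1 ∨ T s = v
      · simp only [g, if_pos h]
        exact hσS _ (hf'.mem _ (hσS s hs) (by rwa [hT2]))
      · simp only [g, if_neg h]
        exact hf.mem s hs h1
    · by_cases h : T s = u + 1 ∨ T s = v
      · simp only [g, if_pos h]
        exact hlt' s hs h
      · simp only [g, if_neg h]
        exact hf.lt s hs h1
    · have e : T s = T t := by
        rw [← lev s hs h1, ← lev t ht h2, h3]
      by_cases h : T s = u + 1 ∨ T s = v
      · have h' : T t = u + 1 ∨ T t = v := by rwa [← e]
        simp only [g, if_pos h, if_pos h'] at h3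
        exact σ.injective (hf'.inj _ (hσS s hs) _ (hσS t ht) (by rwa [hT2]) (by rwa [hT2])
          (σ.injective h3))
      · have h' : ¬ (T t = u + 1 ∨ T t = v) := by rwa [← e]
        simp only [g, if_neg h, if_neg h'] at h3
        exact hf.inj s hs t ht h1 h2 h3
  have hc := hg.isChainLabel hpos hb
  have hv1 : 1 < T j := by omega
  have hor : T j = u + 1 ∨ T j = v := Or.inr rfl
  have hgj : g j = f' q := by
    have h1 : q < f' q := hf'.lt q hq (by rw [hT, hσq]; exact hv1)
    simp only [g, if_pos hor]
    rw [hσj, hσn _ (by omega) (by omega)]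
  have hqj : q < g j := hgj ▸ hf'.lt q hq (by rw [hT, hσq]; exact hv1)
  have hpS := hg.mem j hj hv1
  -- The successor `t` of `q` in its chain satisfies `f' t = j`, so it lies to the left of `j`, and
  -- so do all later elements. In particular `j` is not in the chain of `q`.
  have hnext : ∀ s ∈ S, IsPredMap.label T g s = IsPredMap.label T g q → u < T s → s < j := by
    intro s hs h hus
    obtain ⟨t, ht, ht1, ht2⟩ := hc.exists_level _ (u + 1) s hs rfl (by omega) (by omega)
    have h1 : 1 < T t := by omega
    have hgq : g t = q := hc.inj _ (hg.mem t ht h1) q hq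
      (by rw [hg.label_apply ht h1, ht1, h]) (by have := hg.level t ht h1; omega)
    have htq : t < q := hgq ▸ hg.lt t ht h1
    have htj : t ≠ j := by
      rintro rfl
      omega
    have hor : T t = u + 1 ∨ T t = v := Or.inl ht2
    simp only [g, if_pos hor] at hgq
    rw [hσn t (by omega) htj] at hgq
    have h2 : f' t = j := by rw [← hσσ (f' t), hgq, hσq]
    have h3 := hf'.lt t ht (by rw [hT, hσn t (by omega) htj]; exact h1)
    rw [h2] at h3
    rcases (show T t ≤ T s by omega).eq_or_lt with h4 | h4
    · rw [← hc.inj t ht s hs ht1 h4]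
      exact h3
    · exact (hg.lt_of_label_eq hpos _ t s ht hs rfl h4 ht1).trans h3
  refine ⟨_, g j, ⟨hc, hq, hpS, hlt, lev j hj hv1, hb _ hpS _ hq hqj, ?_⟩,
    (hg.label_apply hj hv1).symm, fun s hs h1 h2 => hb j hj s hs (hnext s hs h1 h2)⟩
  rw [hg.label_apply hj hv1]
  exact fun h => lt_irrefl _ (hnext j hj h hlt)

/-! ### The modules `N_β` and their quotients -/

namespace YoungDiagram

theorem colLen_eq_zero (δ : YoungDiagram) {t : ℕ} (h : δ.rowLen 0 ≤ t) : δ.colLen t = 0 := by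
  by_contra hn
  have : (0, t) ∈ δ := mem_iff_lt_colLen.2 (by omega)
  have := mem_iff_lt_rowLen.1 this
  omega

theorem sum_colLen (δ : YoungDiagram) : ∑ j : Fin (δ.rowLen 0), δ.colLen j = δ.card := by
  rw [Fin.sum_univ_eq_sum_range (fun j => δ.colLen j), YoungDiagram.card,
    Finset.card_eq_sum_card_fiberwise (f := Prod.snd) (t := Finset.range (δ.rowLen 0))]
  · exact Finset.sum_congr rfl fun j _ => δ.colLen_eq_card
  · rintro ⟨i, j⟩ hc
    have h0 : (0, j) ∈ δ := δ.up_left_mem (Nat.zero_le i) le_rfl hc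
    simpa using mem_iff_lt_rowLen.1 h0

end YoungDiagram

namespace NilpModule

variable {k : Type u} [Field k] {β δ : YoungDiagram}

/-- The generator of the `t`-th summand of `N_β` (zero if there is none). -/
noncomputable def basisVec (k : Type u) [Field k] (β : YoungDiagram) (t : ℕ) : NilpModule k β :=
  if h : t < β.rowLen 0 then Pi.single ⟨t, h⟩ (Submodule.Quotient.mk 1) else 0

theorem smul_single_mk_one (i : Fin (β.rowLen 0)) (f : k[X]) :
    f • (Pi.single i (Submodule.Quotient.mk 1) : NilpModule k β) =
      Pi.single i (Submodule.Quotient.mk f) := by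
  have h := (LinearMap.single k[X]
    (fun j : Fin (β.rowLen 0) => k[X] ⧸ Ideal.span {(X : k[X]) ^ β.colLen j}) i).map_smul f
    (Submodule.Quotient.mk 1)
  rw [← Submodule.Quotient.mk_smul, smul_eq_mul, mul_one] at h
  exact h.symm

theorem X_pow_smul_basisVec (t : ℕ) : (X : k[X]) ^ β.colLen t • basisVec k β t = 0 := by
  unfold basisVec
  split_ifs with h
  · rw [smul_single_mk_one,
      (Submodule.Quotient.mk_eq_zero _).2 (Ideal.mem_span_singleton_self _), Pi.single_zero]
  · exact smul_zero _

theorem X_pow_smul_basisVec_of_le {t n : ℕ} (h : β.colLen t ≤ n) :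
    (X : k[X]) ^ n • basisVec k β t = 0 := by
  obtain ⟨m, rfl⟩ := Nat.exists_eq_add_of_le' h
  rw [pow_add, mul_smul, X_pow_smul_basisVec, smul_zero]

theorem span_basisVec : Submodule.span k[X] (Set.range (basisVec k β)) = ⊤ := by
  refine eq_top_iff.2 fun x _ => ?_
  rw [← Finset.univ_sum_single x]
  refine Submodule.sum_mem _ fun i _ => ?_
  obtain ⟨f, hf⟩ := Submodule.Quotient.mk_surjective _ (x i)
  have : Pi.single i (x i) = f • basisVec k β i := by
    rw [basisVec, dif_pos i.2, smul_single_mk_one, hf]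
  rw [this]
  exact Submodule.smul_mem _ _ (Submodule.subset_span ⟨_, rfl⟩)

/-- The linear map from `N_δ` which sends the generators to given elements. -/
noncomputable def lift {M : Type*} [AddCommGroup M] [Module k[X] M] (m : ℕ → M)
    (h : ∀ t, (X : k[X]) ^ δ.colLen t • m t = 0) : NilpModule k δ →ₗ[k[X]] M :=
  LinearMap.lsum k[X] _ k[X] fun j => Submodule.liftQ _ (LinearMap.toSpanSingleton k[X] M (m j))
    (by
      rw [Ideal.span, Submodule.span_singleton_le_iff_mem, LinearMap.mem_ker,
        LinearMap.toSpanSingleton_apply]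
      exact h j)

theorem lift_basisVec {M : Type*} [AddCommGroup M] [Module k[X] M] (m : ℕ → M)
    (h : ∀ t, (X : k[X]) ^ δ.colLen t • m t = 0) (t : ℕ) : lift m h (basisVec k δ t) = m t := by
  by_cases ht : t < δ.rowLen 0
  · rw [lift, basisVec, dif_pos ht, LinearMap.lsum_piSingle, Submodule.liftQ_apply,
      LinearMap.toSpanSingleton_apply, one_smul]
  -- Here the column length is `0`, so the hypothesis on `m` forces `m t = 0`.
  · have := h t
    rw [δ.colLen_eq_zero (not_lt.1 ht), pow_zero, one_smul] at this
    rw [this, basisVec, dif_neg ht, map_zero]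

instance (n : ℕ) : Module.Finite k (k[X] ⧸ Ideal.span {(X : k[X]) ^ n}) :=
  (monic_X_pow n).finite_quotient

theorem finrank_eq_card (β : YoungDiagram) : Module.finrank k (NilpModule k β) = β.card := by
  rw [Module.finrank_pi_fintype, ← β.sum_colLen]
  refine Finset.sum_congr rfl fun j _ => ?_
  rw [finrank_quotient_span_eq_natDegree, natDegree_X_pow]

theorem finrank_quotient_add_finrank (W : Submodule k[X] (NilpModule k β)) :
    Module.finrank k (NilpModule k β ⧸ W) + Module.finrank k W = β.card := by
  have h : LinearMap.range (W.mkQ.restrictScalars k) = ⊤ :=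
    LinearMap.range_eq_top.2 W.mkQ_surjective
  rw [← finrank_eq_card (k := k), ← LinearMap.finrank_range_add_finrank_ker
    (W.mkQ.restrictScalars k), h, finrank_top, LinearMap.ker_restrictScalars, W.ker_mkQ]
  rfl

/-- The submodule of `N_β` generated by the summands of dimension greater than `h`. -/
noncomputable def above (k : Type u) [Field k] (β : YoungDiagram) (h : ℕ) :
    Submodule k[X] (NilpModule k β) :=
  Submodule.span k[X] (basisVec k β '' {t | h < β.colLen t})

/-- A criterion for `N_β / W ≅ N_δ`, in terms of a unitriangular system of generators. -/
theorem nonempty_quotient_equiv (W : Submodule k[X] (NilpModule k β)) (x : ℕ → NilpModule k β)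
    (hx : ∀ t, x t - basisVec k β t ∈ above k β (β.colLen t))
    (hW : ∀ t, (X : k[X]) ^ δ.colLen t • x t ∈ W)
    (hdim : δ.card + Module.finrank k W ≤ β.card) :
    Nonempty ((NilpModule k β ⧸ W) ≃ₗ[k[X]] NilpModule k δ) := by
  have h0 : ∀ t, (X : k[X]) ^ δ.colLen t • W.mkQ (x t) = 0 := fun t => by
    rw [← map_smul, Submodule.mkQ_apply, Submodule.Quotient.mk_eq_zero]
    exact hW t
  let ψ : NilpModule k δ →ₗ[k[X]] (NilpModule k β ⧸ W) := lift (fun t => W.mkQ (x t)) h0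
  -- Induction from long to short columns: `x t` differs from the generator only by generators of
  -- strictly longer columns.
  have key : ∀ n t, β.colLen 0 < β.colLen t + n →
      basisVec k β t ∈ (LinearMap.range ψ).comap W.mkQ := by
    intro n
    induction n with
    | zero =>
      intro t ht
      have := β.colLen_anti 0 t (Nat.zero_le t)
      omega
    | succ n ih =>
      intro t ht
      have h1 : above k β (β.colLen t) ≤ (LinearMap.range ψ).comap W.mkQ := by
        refine Submodule.span_le.2 ?_
        rintro _ ⟨s, hs, rfl⟩
        have hs' : β.colLen t < β.colLen s := hs
        exact ih s (by omega)
      have h2 : x t ∈ (LinearMap.range ψ).comap W.mkQ :=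
        ⟨basisVec k δ t, lift_basisVec _ _ t⟩
      simpa using Submodule.sub_mem _ h2 (h1 (hx t))
  have hsurj : Function.Surjective ψ := by
    have h1 : (LinearMap.range ψ).comap W.mkQ = ⊤ := by
      refine eq_top_iff.2 ?_
      rw [← span_basisVec, Submodule.span_le]
      rintro _ ⟨t, rfl⟩
      exact key (β.colLen 0 + 1) t (by omega)
    intro z
    obtain ⟨y, rfl⟩ := W.mkQ_surjective z
    have : y ∈ (LinearMap.range ψ).comap W.mkQ := h1 ▸ Submodule.mem_top
    exact this
  have h1 := finrank_quotient_add_finrank W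
  have h2 := finrank_eq_card (k := k) δ
  have h3 : Module.finrank k (NilpModule k β ⧸ W) ≤ Module.finrank k (NilpModule k δ) :=
    LinearMap.finrank_le_finrank_of_surjective (f := ψ.restrictScalars k) hsurj
  -- The bound `hdim` excludes a kernel of the surjection `ψ`.
  have hinj : Function.Injective ψ :=
    (LinearMap.injective_iff_surjective_of_finrank_eq_finrank (f := ψ.restrictScalars k)
      (by omega)).2 hsurj
  exact ⟨(LinearEquiv.ofBijective ψ ⟨hinj, hsurj⟩).symm⟩

end NilpModule

/-! ### Spans of families which are permuted by the operator -/

section Span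

variable {k : Type u} [Field k] {B : Type*} [AddCommGroup B] [Module k[X] B]

/-- The submodule generated by the elements of a family of a level greater than `e`. -/
noncomputable def levelSpan (S : Finset ℕ) (T : ℕ → ℕ) (x : ℕ → B) (e : ℕ) : Submodule k[X] B :=
  Submodule.span k[X] (x '' {s | s ∈ S ∧ e < T s})

/-- The operator moves every element of a family to an element of a higher level or to zero,
and every element of a level `e + 1 ≥ 2` is obtained from one of the level `e`. -/
structure IsShiftFamily (k : Type u) [Field k] [Module k[X] B] (S : Finset ℕ) (T : ℕ → ℕ)
    (x : ℕ → B) : Prop where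
  smul : ∀ s ∈ S, (X : k[X]) • x s = 0 ∨
    ∃ t ∈ S, T s < T t ∧ (X : k[X]) • x s = x t
  pred : ∀ t ∈ S, 1 < T t → ∃ s ∈ S, T s + 1 = T t ∧ (X : k[X]) • x s = x t

namespace IsShiftFamily

variable {S : Finset ℕ} {T : ℕ → ℕ} {x : ℕ → B}

/-- Jumps over several levels are harmless as long as every element of level at least `2` is also
reached from the level just below. Such jumps occur when an entry is increased: the old predecessor
of `q` is still mapped to `q`. -/
theorem X_pow_smul_levelSpan (h : IsShiftFamily k S T x) (e : ℕ) :
    (X : k[X]) ^ e • levelSpan (k := k) S T x 0 = levelSpan S T x e := by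
  induction e with
  | zero => rw [pow_zero, one_smul]
  | succ e ih =>
    rw [pow_succ', mul_smul, ih]
    unfold levelSpan
    rw [Submodule.smul_span]
    refine le_antisymm (Submodule.span_le.2 ?_) (Submodule.span_le.2 ?_)
    · rintro _ ⟨_, ⟨s, ⟨hs, hse⟩, rfl⟩, rfl⟩
      rcases h.smul s hs with h0 | ⟨t, ht, htl, h0⟩
      · simp [h0]
      · simp only [h0]
        exact Submodule.subset_span ⟨t, ⟨ht, by omega⟩, rfl⟩
    · rintro _ ⟨t, ⟨ht, hte⟩, rfl⟩
      obtain ⟨s, hs, hst, h0⟩ := h.pred t ht (by omega)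
      exact Submodule.subset_span ⟨_, ⟨s, ⟨hs, by omega⟩, rfl⟩, h0⟩

variable [Module k B] [IsScalarTower k k[X] B]

/-- The `k`-span of the family is already stable under `X`; this makes dimensions countable by
elements of the family. -/
theorem restrictScalars_levelSpan (h : IsShiftFamily k S T x) (e : ℕ) :
    (levelSpan (k := k) S T x e).restrictScalars k =
      Submodule.span k (x '' {s | s ∈ S ∧ e < T s}) := by
  set N := Submodule.span k (x '' {s | s ∈ S ∧ e < T s})
  have hX : ∀ y ∈ N, (X : k[X]) • y ∈ N := by
    intro y hy
    induction hy using Submodule.span_induction with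
    | mem y hy =>
      obtain ⟨s, ⟨hs, hse⟩, rfl⟩ := hy
      rcases h.smul s hs with h0 | ⟨t, ht, htl, h0⟩
      · simp [h0]
      · rw [h0]
        exact Submodule.subset_span ⟨t, ⟨ht, by omega⟩, rfl⟩
    | zero => simp
    | add y z _ _ hy hz => rw [smul_add]; exact N.add_mem hy hz
    | smul a y _ hy =>
      rw [← algebraMap_smul k[X] a y, smul_comm, algebraMap_smul]
      exact N.smul_mem _ hy
  have hXn : ∀ (n : ℕ), ∀ y ∈ N, (X : k[X]) ^ n • y ∈ N := by
    intro n
    induction n with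
    | zero => intro y hy; simpa using hy
    | succ n ih => intro y hy; rw [pow_succ', mul_smul]; exact hX _ (ih y hy)
  have hp : ∀ (f : k[X]), ∀ y ∈ N, f • y ∈ N := by
    intro f y hy
    induction f using Polynomial.induction_on' with
    | add f g hf hg => rw [add_smul]; exact N.add_mem hf hg
    | monomial n a =>
      rw [← C_mul_X_pow_eq_monomial, mul_smul, ← algebraMap_eq, algebraMap_smul]
      exact N.smul_mem _ (hXn n y hy)
  refine le_antisymm ?_ ?_
  · let N' : Submodule k[X] B :=
      { N with smul_mem' := fun f y hy => hp f y hy }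
    have : levelSpan (k := k) S T x e ≤ N' := Submodule.span_le.2 Submodule.subset_span
    exact this
  · exact Submodule.span_le.2 (Submodule.subset_span (R := k[X]))

theorem finrank_levelSpan_le (h : IsShiftFamily k S T x) (e : ℕ) :
    Module.finrank k (levelSpan (k := k) S T x e) ≤ (S.filter (fun s => e < T s)).card := by
  classical
  have h1 : Module.finrank k (levelSpan (k := k) S T x e) =
      Module.finrank k ((levelSpan (k := k) S T x e).restrictScalars k) := rfl
  rw [h1, h.restrictScalars_levelSpan]
  have h2 := finrank_span_finset_le_card (R := k) ((S.filter (fun s => e < T s)).image x)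
  rw [Finset.coe_image, Finset.coe_filter] at h2
  exact h2.trans Finset.card_image_le

end IsShiftFamily

end Span

/-! ### Extensions from a direct sum decomposition of the ambient module -/

namespace NilpEmbedding

variable {k : Type u} [Field k]

theorem Iso.refl (E : NilpEmbedding k) : Iso E E := ⟨LinearEquiv.refl _ _, by simp⟩

/-- If `π` is an idempotent endomorphism of the ambient module, `A'` is the direct sum of its
intersections with the range and the kernel of `π`, and `A` has the same intersection with the range
and the same projection to the kernel, then `(A ⊂ B) ≤_ext (A' ⊂ B)`. -/
theorem extLE_of_idempotent {B : Type u} [AddCommGroup B] [Module k[X] B] [Module.Finite k[X] B]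
    (hB : ∃ n : ℕ, ∀ b : B, (X : k[X]) ^ n • b = 0) (π : B →ₗ[k[X]] B) (hπ : ∀ x, π (π x) = π x)
    (A A' : Submodule k[X] B) (h0 : ∀ x ∈ A', π x ∈ A') (h1 : ∀ x ∈ A, x - π x ∈ A')
    (h2 : ∀ x ∈ A', ∃ z ∈ A, z - π z = x - π x) (h3 : ∀ x ∈ A', π x ∈ A)
    (h4 : ∀ x ∈ A, π x = x → x ∈ A') :
    ExtLE (⟨B, hB, A⟩ : NilpEmbedding k) ⟨B, hB, A'⟩ := by
  obtain ⟨n, hn⟩ := hB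
  let U : NilpEmbedding k := ⟨LinearMap.range π, ⟨n, fun b => Subtype.ext (hn b)⟩,
    A'.comap (LinearMap.range π).subtype⟩
  let V : NilpEmbedding k := ⟨LinearMap.ker π, ⟨n, fun b => Subtype.ext (hn b)⟩,
    A'.comap (LinearMap.ker π).subtype⟩
  have hrange : ∀ x : LinearMap.range π, π x = x := by
    rintro ⟨_, y, rfl⟩
    exact hπ y
  have hker : ∀ x : LinearMap.ker π, π x = 0 := fun x => x.2
  let g : B →ₗ[k[X]] LinearMap.ker π :=
    LinearMap.codRestrict (LinearMap.ker π) (LinearMap.id - π) (fun x => by simp [hπ])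
  have hg : ∀ x, (g x : B) = x - π x := fun x => rfl
  let E : NilpEmbedding k := ⟨B, ⟨n, hn⟩, A⟩
  let E' : NilpEmbedding k := ⟨B, ⟨n, hn⟩, A'⟩
  have hUA : ∀ x : LinearMap.range π, (x : B) ∈ A' → (x : B) ∈ A := fun x hx => by
    rw [← hrange x]
    exact h3 _ hx
  -- One extension suffices: `U` and `V` are the parts of `A'` in the range and the kernel of `π`,
  -- and `id - π` is the map onto `V`.
  refine ⟨1, fun i => if i = 0 then E else E', fun _ => U, fun _ => V, ?_, ?_, ?_⟩
  · exact Iso.refl E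
  · intro i hi
    obtain rfl : i = 0 := by omega
    change HasShortExact U E V ∧ Iso (directSum U V) E'
    refine ⟨⟨(LinearMap.range π).subtype, g, fun x hx => hUA x hx, fun x hx => h1 x hx,
      ⟨Subtype.val_injective, ?_, ?_⟩, ?_, ?_, ?_⟩, ?_⟩
    · intro x
      constructor
      · intro hx
        have : (g x : B) = 0 := congrArg Subtype.val hx
        rw [hg, sub_eq_zero] at this
        exact ⟨⟨x, x, this.symm⟩, rfl⟩
      · rintro ⟨y, rfl⟩
        refine Subtype.ext ?_
        rw [hg]
        exact sub_eq_zero.2 (hrange y).symm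
    · intro y
      refine ⟨y, Subtype.ext ?_⟩
      rw [hg, hker, sub_zero]
    · intro x y hxy
      exact Subtype.ext (Subtype.ext (congrArg Subtype.val hxy :))
    · rintro ⟨x, hx⟩
      constructor
      · intro hgx
        have h5 : (g x : B) = 0 := congrArg (fun z => ((z : LinearMap.ker π) : B))
          (congrArg Subtype.val hgx)
        rw [hg, sub_eq_zero] at h5
        exact ⟨⟨⟨x, x, h5.symm⟩, h4 x hx h5.symm⟩, Subtype.ext rfl⟩
      · rintro ⟨⟨y, hy⟩, hyx⟩
        have h5 : (y : B) = x := congrArg Subtype.val hyx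
        refine Subtype.ext (Subtype.ext ?_)
        change (g x : B) = 0
        rw [hg, ← h5, hrange, sub_self]
    · rintro ⟨y, hy⟩
      obtain ⟨z, hz, hzy⟩ := h2 y hy
      refine ⟨⟨z, hz⟩, Subtype.ext (Subtype.ext ?_)⟩
      change (g z : B) = y
      rw [hg, hzy, hker, sub_zero]
    · let f : (LinearMap.range π × LinearMap.ker π) →ₗ[k[X]] B :=
        LinearMap.coprod (LinearMap.range π).subtype (LinearMap.ker π).subtype
      have hf : ∀ x, f x = x.1 + x.2 := fun x => rfl
      have hπf : ∀ x, π (f x) = x.1 := fun x => by rw [hf, map_add, hrange, hker, add_zero]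
      have hbij : Function.Bijective f := by
        constructor
        · intro x y hxy
          have e1 : (x.1 : B) = y.1 := by rw [← hπf, ← hπf, hxy]
          have e2 : (x.2 : B) = y.2 := by
            rw [hf, hf, e1] at hxy
            exact add_left_cancel hxy
          exact Prod.ext (Subtype.ext e1) (Subtype.ext e2)
        · intro x
          refine ⟨(⟨π x, x, rfl⟩, g x), ?_⟩
          rw [hf, hg]
          exact add_sub_cancel _ _
      refine ⟨LinearEquiv.ofBijective f hbij, ?_⟩
      refine le_antisymm ?_ ?_
      · rintro _ ⟨⟨x, y⟩, ⟨hx, hy⟩, rfl⟩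
        exact A'.add_mem hx hy
      · intro x hx
        refine ⟨(⟨π x, x, rfl⟩, g x), ⟨h0 x hx, A'.sub_mem hx (h0 x hx)⟩, ?_⟩
        change f _ = x
        rw [hf, hg]
        exact add_sub_cancel _ _
  · exact Iso.refl E'

end NilpEmbedding

/-! ### Columns of a horizontal strip -/

namespace YoungDiagram

variable {β γ : YoungDiagram}

/-- The columns of `β ∖ γ` which contain a cell. -/
def skewCols (β γ : YoungDiagram) : Finset ℕ :=
  (Finset.range (β.rowLen 0)).filter (fun j => γ.colLen j < β.colLen j)

theorem mem_skewCols {j : ℕ} : j ∈ skewCols β γ ↔ γ.colLen j < β.colLen j := by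
  simp only [skewCols, Finset.mem_filter, Finset.mem_range, and_iff_right_iff_imp]
  intro h
  by_contra hn
  have := β.colLen_eq_zero (not_lt.1 hn)
  omega

theorem IsHorizontalStrip.colLen_eq (h : IsHorizontalStrip β γ) {j : ℕ} (hj : j ∈ skewCols β γ) :
    β.colLen j = γ.colLen j + 1 := by
  have := h.2 j
  have := mem_skewCols.1 hj
  omega

theorem IsHorizontalStrip.mem_skewCells (h : IsHorizontalStrip β γ) {i j : ℕ} :
    (i, j) ∈ skewCells β γ ↔ j ∈ skewCols β γ ∧ i = γ.colLen j := by
  rw [skewCells, Finset.mem_sdiff, mem_cells, mem_cells, mem_iff_lt_colLen, mem_iff_lt_colLen,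
    mem_skewCols]
  have := h.2 j
  omega

theorem IsHorizontalStrip.skewCells_eq_image (h : IsHorizontalStrip β γ) :
    skewCells β γ = (skewCols β γ).image (fun j => (γ.colLen j, j)) := by
  ext ⟨i, j⟩
  rw [h.mem_skewCells, Finset.mem_image]
  constructor
  · rintro ⟨h1, rfl⟩
    exact ⟨j, h1, rfl⟩
  · rintro ⟨j', h1, h2⟩
    obtain ⟨rfl, rfl⟩ := Prod.mk.inj h2
    exact ⟨h1, rfl⟩

theorem IsHorizontalStrip.card_filter (h : IsHorizontalStrip β γ) (P : ℕ × ℕ → Prop)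
    [DecidablePred P] : ((skewCells β γ).filter P).card =
      ((skewCols β γ).filter (fun j => P (γ.colLen j, j))).card := by
  rw [h.skewCells_eq_image, Finset.filter_image, Finset.card_image_of_injective]
  intro a b hab
  exact (Prod.mk.inj hab).2

/-- Two strip columns of equal length would have their cells in the same row, which a vertical strip
forbids. -/
theorem IsRookStrip.colLen_lt (h : IsRookStrip β γ) {s t : ℕ} (hs : s ∈ skewCols β γ)
    (ht : t ∈ skewCols β γ) (hts : t < s) : β.colLen s < β.colLen t := by
  refine lt_of_le_of_ne (β.colLen_anti t s hts.le) fun he => ?_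
  have h1 := h.1.colLen_eq hs
  have h2 := h.1.colLen_eq ht
  have h3 := h.2.2 (γ.colLen s)
  rw [colLen_transpose, colLen_transpose] at h3
  have h4 : (γ.colLen s, s) ∈ β := mem_iff_lt_colLen.2 (by omega)
  have h5 : (γ.colLen s, t) ∉ γ := fun hc => by
    have := mem_iff_lt_colLen.1 hc
    omega
  rw [mem_iff_lt_rowLen] at h4 h5
  omega

end YoungDiagram

/-! ### Tableaux on a horizontal strip as functions of the column -/

namespace LRTableau

open YoungDiagram

variable {β γ : YoungDiagram}

/-- The entry in a column of a horizontal strip. -/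
def colEntry (T : LRTableau β γ) (j : ℕ) : ℕ := T.entry (γ.colLen j) j

theorem colEntry_pos (h : IsHorizontalStrip β γ) (T : LRTableau β γ) {j : ℕ}
    (hj : j ∈ skewCols β γ) : 0 < T.colEntry j := T.pos _ _ (h.mem_skewCells.2 ⟨hj, rfl⟩)

theorem exists_isPredMap (h : IsHorizontalStrip β γ) (T : LRTableau β γ) :
    ∃ f, IsPredMap (skewCols β γ) T.colEntry f := by
  refine _root_.exists_isPredMap _ _ fun j e he => ?_
  have := T.lattice j e he
  rwa [h.card_filter, h.card_filter] at this

theorem mem_stage (T : LRTableau β γ) {e i j : ℕ} :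
    (i, j) ∈ T.stage e ↔ (i, j) ∈ β ∧ T.entry i j ≤ e := by
  rw [← mem_cells, stage, Finset.mem_filter, mem_cells]

theorem colLen_stage (h : IsHorizontalStrip β γ) (T : LRTableau β γ) (e j : ℕ) :
    (T.stage e).colLen j =
      if j ∈ skewCols β γ ∧ e < T.colEntry j then β.colLen j - 1 else β.colLen j := by
  refine eq_of_forall_lt_iff fun i => ?_
  rw [← mem_iff_lt_colLen, mem_stage, mem_iff_lt_colLen]
  by_cases hj : j ∈ skewCols β γ
  · have h1 := h.colLen_eq hj
    by_cases hi : i = γ.colLen j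
    · subst hi
      change _ ∧ T.colEntry j ≤ e ↔ _
      split_ifs with h2
      · omega
      · have : ¬ e < T.colEntry j := fun h3 => h2 ⟨hj, h3⟩
        omega
    · rw [T.zero i j (fun h2 => hi (h.mem_skewCells.1 h2).2)]
      split_ifs <;> omega
  · rw [T.zero i j (fun h2 => hj (h.mem_skewCells.1 h2).1), if_neg (fun h2 => hj h2.1)]
    simp

theorem card_stage (h : IsHorizontalStrip β γ) (T : LRTableau β γ) (e : ℕ) :
    (T.stage e).card + ((skewCols β γ).filter (fun j => e < T.colEntry j)).card = β.card := by
  have h1 : (skewCells β γ).filter (fun c => e < T.entry c.1 c.2) =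
      β.cells.filter (fun c => ¬ T.entry c.1 c.2 ≤ e) := by
    ext ⟨i, j⟩
    simp only [Finset.mem_filter, not_le]
    refine ⟨fun h2 => ⟨(Finset.mem_sdiff.1 h2.1).1, h2.2⟩, fun h2 => ⟨?_, h2.2⟩⟩
    by_contra hn
    have := T.zero i j hn
    omega
  have h2 := h.card_filter (fun c => e < T.entry c.1 c.2)
  rw [h1] at h2
  have h3 : (T.stage e).card = (β.cells.filter (fun c => T.entry c.1 c.2 ≤ e)).card := rfl
  change _ = ((skewCols β γ).filter (fun j => e < T.colEntry j)).card at h2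
  rw [← h2, h3, Finset.card_filter_add_card_filter_not]

theorem stage_zero (T : LRTableau β γ) : T.stage 0 = γ := by
  ext ⟨i, j⟩
  rw [mem_cells, mem_cells, mem_stage]
  constructor
  · rintro ⟨h1, h2⟩
    by_contra h3
    have := T.pos i j (Finset.mem_sdiff.2 ⟨h1, h3⟩)
    omega
  · intro h1
    refine ⟨T.le h1, (T.zero i j fun h2 => (Finset.mem_sdiff.1 h2).2 h1).le⟩

/-- The upper cell lies in the shorter column and receives the larger entry, so `q` is again the
column whose entry increases. -/
theorem IsSwap.exists_colEntry (h : IsHorizontalStrip β γ) {Δ Γ : LRTableau β γ}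
    (hs : IsSwap Δ Γ) : ∃ q ∈ skewCols β γ, ∃ j ∈ skewCols β γ, β.colLen q < β.colLen j ∧
      Γ.colEntry q < Γ.colEntry j ∧ ∀ s, Δ.colEntry s = Γ.colEntry (Equiv.swap q j s) := by
  obtain ⟨i, q, i', j, h1, h2, h3, h4, h5, h6, h7⟩ := hs
  obtain ⟨hq, rfl⟩ := h.mem_skewCells.1 h1
  obtain ⟨hj, rfl⟩ := h.mem_skewCells.1 h2
  refine ⟨q, hq, j, hj, ?_, h4, fun s => ?_⟩
  · rw [h.colLen_eq hq, h.colLen_eq hj]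
    omega
  · by_cases e1 : s = q
    · rw [e1, Equiv.swap_apply_left]
      exact h5
    · by_cases e2 : s = j
      · rw [e2, Equiv.swap_apply_right]
        exact h6
      · rw [Equiv.swap_apply_of_ne_of_ne e1 e2]
        exact h7 _ _ (fun hc => e1 (Prod.mk.inj hc).2) (fun hc => e2 (Prod.mk.inj hc).2)

theorem IsIncrease.exists_colEntry (h : IsHorizontalStrip β γ) {Δ Γ : LRTableau β γ}
    (hs : IsIncrease Δ Γ) : ∃ q ∈ skewCols β γ, Γ.colEntry q < Δ.colEntry q ∧
      ∀ s, s ≠ q → Δ.colEntry s = Γ.colEntry s := by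
  obtain ⟨i, q, h1, h2, h3⟩ := hs
  obtain ⟨hq, rfl⟩ := h.mem_skewCells.1 h1
  exact ⟨q, hq, h2, fun s e1 => h3 _ _ fun hc => e1 (Prod.mk.inj hc).2⟩

end LRTableau

/-! ### Embeddings with a given tableau -/

namespace NilpModule

open YoungDiagram

variable {k : Type u} [Field k] {β γ : YoungDiagram}

theorem exists_X_pow_smul_eq_zero (k : Type u) [Field k] (β : YoungDiagram) :
    ∃ n : ℕ, ∀ b : NilpModule k β, (X : k[X]) ^ n • b = 0 := by
  refine ⟨β.colLen 0, fun b => ?_⟩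
  have hb : b ∈ Submodule.span k[X] (Set.range (basisVec k β)) :=
    span_basisVec (k := k) (β := β) ▸ Submodule.mem_top
  induction hb using Submodule.span_induction with
  | mem y hy =>
    obtain ⟨t, rfl⟩ := hy
    exact X_pow_smul_basisVec_of_le (β.colLen_anti 0 t (Nat.zero_le t))
  | zero => exact smul_zero _
  | add y z _ _ hy hz => rw [smul_add, hy, hz, add_zero]
  | smul a y _ hy => rw [smul_comm, hy, smul_zero]

/-- The embedding of a submodule of `N_β`. -/
noncomputable def embedding (A : Submodule k[X] (NilpModule k β)) : NilpEmbedding k :=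
  ⟨NilpModule k β, exists_X_pow_smul_eq_zero k β, A⟩

/-- The remainders which are admitted in an element of height `h - 1`: multiples by `X ^ (h - 1)` of
combinations of the generators of order greater than `h`. -/
noncomputable def remainder (k : Type u) [Field k] (β : YoungDiagram) (h : ℕ) :
    Submodule k[X] (NilpModule k β) := (X : k[X]) ^ (h - 1) • above k β h

theorem X_pow_smul_basisVec_mem_remainder {h m t : ℕ} (hm : h - 1 ≤ m) (ht : h < β.colLen t) :
    (X : k[X]) ^ m • basisVec k β t ∈ remainder k β h := by
  obtain ⟨n, rfl⟩ := Nat.exists_eq_add_of_le hm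
  rw [pow_add, mul_smul]
  exact Submodule.smul_mem_pointwise_smul _ _ _
    (Submodule.smul_mem _ _ (Submodule.subset_span ⟨t, ht, rfl⟩))

/-- A criterion for an embedding into `N_β` to have a given tableau, in terms of a unitriangular
system of elements of the submodule. -/
theorem hasTableau_embedding (h : IsHorizontalStrip β γ) (T : LRTableau β γ)
    (A : Submodule k[X] (NilpModule k β)) (w : ℕ → NilpModule k β)
    (hw : ∀ s ∈ skewCols β γ, w s - (X : k[X]) ^ (β.colLen s - 1) • basisVec k β s ∈
      remainder k β (β.colLen s))
    (hA : ∀ e, ∀ s ∈ skewCols β γ, e < T.colEntry s → w s ∈ (X : k[X]) ^ e • A)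
    (hdim : ∀ e, Module.finrank k ((X : k[X]) ^ e • A : Submodule k[X] (NilpModule k β)) ≤
      ((skewCols β γ).filter (fun s => e < T.colEntry s)).card) :
    (embedding A).HasTableau T := by
  intro e
  change Nonempty ((NilpModule k β ⧸ (X : k[X]) ^ e • A) ≃ₗ[k[X]] NilpModule k (T.stage e))
  have key : ∀ t, ∃ x : NilpModule k β, x - basisVec k β t ∈ above k β (β.colLen t) ∧
      (X : k[X]) ^ (T.stage e).colLen t • x ∈ (X : k[X]) ^ e • A := by
    intro t
    rw [T.colLen_stage h]
    split_ifs with ht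
    -- The remainder is `X ^ (β.colLen t - 1) • y` with `y` in longer columns, so the new generator
    -- `basisVec k β t + y` is sent exactly to `w t`.
    · obtain ⟨y, hy, hy'⟩ := (Submodule.mem_smul_pointwise_iff_exists _ _ _).1 (hw t ht.1)
      refine ⟨basisVec k β t + y, by simpa using hy, ?_⟩
      rw [smul_add, hy', add_sub_cancel]
      exact hA e t ht.1 ht.2
    · refine ⟨basisVec k β t, by simp, ?_⟩
      rw [X_pow_smul_basisVec]
      exact Submodule.zero_mem _
  choose x hx hx' using key
  refine nonempty_quotient_equiv _ x hx hx' ?_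
  have := T.card_stage h e
  have := hdim e
  omega

theorem hasShape_of_hasTableau {A : Submodule k[X] (NilpModule k β)} {T : LRTableau β γ}
    (hT : (embedding A).HasTableau T) : (embedding A).HasShape β γ := by
  refine ⟨⟨LinearEquiv.refl _ _⟩, ?_⟩
  have := hT 0
  rwa [T.stage_zero, pow_zero, one_smul] at this

theorem finrank_eq_card_skewCols (h : IsHorizontalStrip β γ)
    {A : Submodule k[X] (NilpModule k β)} {T : LRTableau β γ}
    (hT : (embedding A).HasTableau T) : Module.finrank k A = (skewCols β γ).card := by
  obtain ⟨f⟩ : Nonempty ((NilpModule k β ⧸ A) ≃ₗ[k[X]] NilpModule k γ) :=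
    (hasShape_of_hasTableau hT).2
  have h1 := finrank_quotient_add_finrank A
  have h2 : Module.finrank k (NilpModule k β ⧸ A) = γ.card := by
    rw [← finrank_eq_card (k := k) γ]
    exact LinearEquiv.finrank_eq (f.restrictScalars k)
  have h3 := T.card_stage h 0
  rw [T.stage_zero, Finset.filter_true_of_mem fun s hs => T.colEntry_pos h hs] at h3
  omega

/-! ### The elements attached to a chain decomposition -/

variable {S : Finset ℕ} {T κ : ℕ → ℕ}

/-- The element of the part of level `≥ n` of the chain `c`, with the height of `basisVec t`
lowered by the distance of `t` to the level `n`. -/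
noncomputable def chainElt (k : Type u) [Field k] (β : YoungDiagram) (S : Finset ℕ) (T κ : ℕ → ℕ)
    (c n : ℕ) : NilpModule k β :=
  ∑ t ∈ S with κ t = c ∧ n ≤ T t, (X : k[X]) ^ (β.colLen t - 1 - (T t - n)) • basisVec k β t

/-- The term of level `n` reaches exponent `β.colLen t` and vanishes; the others are shifted. -/
theorem X_smul_chainElt (hT : ∀ t ∈ S, T t ≤ β.colLen t) {n : ℕ} (hn : 0 < n) (c : ℕ) :
    (X : k[X]) • chainElt k β S T κ c n = chainElt k β S T κ c (n + 1) := by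
  rw [chainElt, chainElt, Finset.smul_sum, Finset.sum_filter, Finset.sum_filter]
  refine Finset.sum_congr rfl fun t ht => ?_
  have h1 := hT t ht
  by_cases h2 : κ t = c ∧ n ≤ T t
  · rw [if_pos h2, ← mul_smul, ← pow_succ']
    split_ifs with h3
    · congr 2
      omega
    · have : T t = n := by
        by_contra h4
        exact h3 ⟨h2.1, by omega⟩
      exact X_pow_smul_basisVec_of_le (by omega)
  · rw [if_neg h2, if_neg fun h3 => h2 ⟨h3.1, by omega⟩]

theorem chainElt_eq_zero {c n : ℕ} (h : ∀ t ∈ S, κ t = c → T t < n) :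
    chainElt k β S T κ c n = 0 := by
  refine Finset.sum_eq_zero fun t ht => ?_
  obtain ⟨h1, h2, h3⟩ := Finset.mem_filter.1 ht
  have := h t h1 h2
  omega

/-- The threshold `h` is not tied to column `s`: for a swap, the tail of the chain of `q` is
compared with the longer column `j`. -/
theorem chainElt_sub_mem_remainder (hκ : IsChainLabel S β.colLen T κ) {s h : ℕ} (hs : s ∈ S)
    (hh : ∀ t ∈ S, κ t = κ s → T s < T t → h < β.colLen t ∧
      h - 1 ≤ β.colLen t - 1 - (T t - T s)) :
    chainElt k β S T κ (κ s) (T s) - (X : k[X]) ^ (β.colLen s - 1) • basisVec k β s ∈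
      remainder k β h := by
  have hs' : s ∈ S.filter (fun t => κ t = κ s ∧ T s ≤ T t) := Finset.mem_filter.2 ⟨hs, rfl, le_rfl⟩
  rw [chainElt, ← Finset.add_sum_erase _ _ hs', Nat.sub_self, Nat.sub_zero, add_sub_cancel_left]
  refine Submodule.sum_mem _ fun t ht => ?_
  obtain ⟨h1, h2⟩ := Finset.mem_erase.1 ht
  obtain ⟨h3, h4, h5⟩ := Finset.mem_filter.1 h2
  have h6 : T s < T t := lt_of_le_of_ne h5 fun h6 => h1 (hκ.inj t h3 s hs h4 h6.symm)
  obtain ⟨h7, h8⟩ := hh t h3 h4 h6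
  exact X_pow_smul_basisVec_mem_remainder h8 h7

theorem chainElt_sub_mem_remainder_self (hκ : IsChainLabel S β.colLen T κ)
    (hpos : ∀ s ∈ S, 0 < T s) {s : ℕ} (hs : s ∈ S) :
    chainElt k β S T κ (κ s) (T s) - (X : k[X]) ^ (β.colLen s - 1) • basisVec k β s ∈
      remainder k β (β.colLen s) := by
  refine chainElt_sub_mem_remainder hκ hs fun t ht h1 h2 => ?_
  have h3 := hκ.add_sub_le hpos _ s t hs ht rfl h1.symm h2.le
  omega

theorem isShiftFamily_chainElt (hκ : IsChainLabel S β.colLen T κ) (hpos : ∀ s ∈ S, 0 < T s)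
    (hT : ∀ t ∈ S, T t ≤ β.colLen t) :
    IsShiftFamily k S T (fun s => chainElt k β S T κ (κ s) (T s)) where
  smul s hs := by
    rw [X_smul_chainElt hT (hpos s hs)]
    by_cases h : ∃ t ∈ S, κ t = κ s ∧ T t = T s + 1
    · obtain ⟨t, ht, h1, h2⟩ := h
      exact Or.inr ⟨t, ht, by omega, by rw [h1, h2]⟩
    · refine Or.inl (chainElt_eq_zero fun t ht h1 => ?_)
      by_contra h2
      obtain ⟨t', ht', h3, h4⟩ := hκ.exists_level _ (T s + 1) t ht rfl (by omega) (by omega)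
      exact h ⟨t', ht', h3.trans h1, h4⟩
  pred t ht h1 := by
    obtain ⟨s, hs, h2, h3⟩ := hκ.pred t ht h1
    refine ⟨s, hs, h3, ?_⟩
    rw [X_smul_chainElt hT (hpos s hs), h2, h3]

/-- The elements `chainElt`, modified by adding the generator `q` on the level `v` of the chain
`d`. -/
noncomputable def moveElt (k : Type u) [Field k] (β : YoungDiagram) (S : Finset ℕ) (T κ : ℕ → ℕ)
    (q d v c n : ℕ) : NilpModule k β :=
  chainElt k β S T κ c n +
    if c = d ∧ n ≤ v then (X : k[X]) ^ (β.colLen q - 1 - (v - n)) • basisVec k β q else 0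

theorem X_smul_moveElt (hT : ∀ t ∈ S, T t ≤ β.colLen t) {q d v n : ℕ} (hv : v ≤ β.colLen q)
    (hn : 0 < n) (c : ℕ) :
    (X : k[X]) • moveElt k β S T κ q d v c n = moveElt k β S T κ q d v c (n + 1) := by
  rw [moveElt, moveElt, smul_add, X_smul_chainElt hT hn]
  congr 1
  by_cases h2 : c = d ∧ n ≤ v
  · rw [if_pos h2, ← mul_smul, ← pow_succ']
    split_ifs with h3
    · congr 2
      omega
    · have : v = n := by
        by_contra h4
        exact h3 ⟨h2.1, by omega⟩
      exact X_pow_smul_basisVec_of_le (by omega)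
  · rw [if_neg h2, if_neg fun h3 => h2 ⟨h3.1, by omega⟩, smul_zero]

theorem moveElt_of_ne {q d v c n : ℕ} (h : c ≠ d) :
    moveElt k β S T κ q d v c n = chainElt k β S T κ c n := by
  rw [moveElt, if_neg fun h1 => h h1.1, add_zero]

end NilpModule

/-! ### Splitting off one chain, and the embeddings for the two box moves -/

namespace NilpModule

open YoungDiagram

variable {k : Type u} [Field k] {β γ : YoungDiagram} {S : Finset ℕ} {T κ : ℕ → ℕ}

/-- The projection onto the summands with label `c`. -/
noncomputable def labelProj (k : Type u) [Field k] (β : YoungDiagram) (κ : ℕ → ℕ) (c : ℕ) :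
    NilpModule k β →ₗ[k[X]] NilpModule k β :=
  LinearMap.pi fun i => if κ i = c then LinearMap.proj i else 0

theorem labelProj_apply (c : ℕ) (x : NilpModule k β) (i : Fin (β.rowLen 0)) :
    labelProj k β κ c x i = if κ i = c then x i else 0 := by
  rw [labelProj, LinearMap.pi_apply]
  split_ifs <;> rfl

theorem labelProj_labelProj (c : ℕ) (x : NilpModule k β) :
    labelProj k β κ c (labelProj k β κ c x) = labelProj k β κ c x := by
  funext i
  rw [labelProj_apply, labelProj_apply]
  split_ifs <;> rfl

theorem labelProj_basisVec (c t : ℕ) :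
    labelProj k β κ c (basisVec k β t) = if κ t = c then basisVec k β t else 0 := by
  funext i
  rw [labelProj_apply]
  by_cases ht : t < β.rowLen 0
  · by_cases hi : i = ⟨t, ht⟩
    · subst hi
      split_ifs <;> rfl
    · have h0 : basisVec k β t i = 0 := by
        rw [basisVec, dif_pos ht, Pi.single_eq_of_ne hi]
      split_ifs
      · rfl
      · exact h0
      · exact h0.symm ▸ rfl
      · rfl
  · have h0 : basisVec k β t = 0 := by rw [basisVec, dif_neg ht]
    rw [h0]
    split_ifs <;> rfl

theorem labelProj_chainElt (c d n : ℕ) :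
    labelProj k β κ c (chainElt k β S T κ d n) = if d = c then chainElt k β S T κ d n else 0 := by
  rw [chainElt, map_sum]
  split_ifs with h
  · refine Finset.sum_congr rfl fun t ht => ?_
    rw [map_smul, labelProj_basisVec, if_pos ((Finset.mem_filter.1 ht).2.1.trans h)]
  · refine Finset.sum_eq_zero fun t ht => ?_
    rw [map_smul, labelProj_basisVec,
      if_neg fun h1 => h ((Finset.mem_filter.1 ht).2.1.symm.trans h1), smul_zero]

theorem hasTableau_levelSpan (hst : IsHorizontalStrip β γ) (Γ : LRTableau β γ)
    (hκ : IsChainLabel (skewCols β γ) β.colLen Γ.colEntry κ) :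
    (embedding (levelSpan (k := k) (skewCols β γ) Γ.colEntry (fun s =>
      chainElt k β (skewCols β γ) Γ.colEntry κ (κ s) (Γ.colEntry s)) 0)).HasTableau Γ := by
  have hpos : ∀ s ∈ skewCols β γ, 0 < Γ.colEntry s := fun s hs => Γ.colEntry_pos hst hs
  have hT : ∀ s ∈ skewCols β γ, Γ.colEntry s ≤ β.colLen s := fun s hs =>
    hκ.level_le (fun t ht => by have := hst.colLen_eq ht; omega) _ s hs rfl
  have hsh := isShiftFamily_chainElt (k := k) hκ hpos hT
  refine hasTableau_embedding hst Γ _ _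
    (fun s hs => chainElt_sub_mem_remainder_self hκ hpos hs) (fun e s hs hes => ?_) (fun e => ?_)
  · rw [hsh.X_pow_smul_levelSpan]
    exact Submodule.subset_span ⟨s, ⟨hs, hes⟩, rfl⟩
  · rw [hsh.X_pow_smul_levelSpan]
    exact hsh.finrank_levelSpan_le e

/-- The elements span a space whose dimension, known from its tableau, equals their number. -/
theorem linearIndepOn_chainElt (hst : IsHorizontalStrip β γ) (Γ : LRTableau β γ)
    (hκ : IsChainLabel (skewCols β γ) β.colLen Γ.colEntry κ) :
    LinearIndepOn k (fun s =>
      chainElt k β (skewCols β γ) Γ.colEntry κ (κ s) (Γ.colEntry s)) (skewCols β γ) := by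
  have hpos : ∀ s ∈ skewCols β γ, 0 < Γ.colEntry s := fun s hs => Γ.colEntry_pos hst hs
  have hT : ∀ s ∈ skewCols β γ, Γ.colEntry s ≤ β.colLen s := fun s hs =>
    hκ.level_le (fun t ht => by have := hst.colLen_eq ht; omega) _ s hs rfl
  have hsh := isShiftFamily_chainElt (k := k) hκ hpos hT
  have h1 := finrank_eq_card_skewCols hst (hasTableau_levelSpan (k := k) hst Γ hκ)
  have h2 := hsh.restrictScalars_levelSpan 0
  refine linearIndependent_iff_card_eq_finrank_span.2 ?_
  have h3 : {s | s ∈ skewCols β γ ∧ 0 < Γ.colEntry s} = (skewCols β γ : Set ℕ) :=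
    Set.ext fun s => ⟨fun h => h.1, fun h => ⟨h, hpos s h⟩⟩
  rw [h3] at h2
  refine Eq.trans ?_ (congrArg (fun s => Module.finrank k (Submodule.span k s))
    (Set.image_eq_range (fun s => chainElt k β (skewCols β γ) Γ.colEntry κ (κ s) (Γ.colEntry s))
      (skewCols β γ)))
  rw [← h2]
  refine Eq.trans ?_ h1.symm
  simp

/-- The submodules generated by `moveElt` and by `chainElt` are related by an extension. -/
theorem extLE_levelSpan {q p v : ℕ} {T' : ℕ → ℕ} (hm : IsMoveLabel S β.colLen T κ q p v)
    (hpos : ∀ s ∈ S, 0 < T s) (hpos' : ∀ s ∈ S, 0 < T' s)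
    (hlin : LinearIndepOn k (fun s => chainElt k β S T κ (κ s) (T s)) S)
    (hx : IsShiftFamily k S T' (fun s => moveElt k β S T κ q (κ p) v (κ s) (T s))) :
    NilpEmbedding.ExtLE
      (embedding (levelSpan (k := k) S T' (fun s => moveElt k β S T κ q (κ p) v (κ s) (T s)) 0))
      (embedding (levelSpan (k := k) S T (fun s => chainElt k β S T κ (κ s) (T s)) 0)) := by
  set y : ℕ → NilpModule k β := fun s => chainElt k β S T κ (κ s) (T s) with hy
  set x : ℕ → NilpModule k β := fun s => moveElt k β S T κ q (κ p) v (κ s) (T s) with hxd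
  set A := levelSpan (k := k) S T' x 0 with hA
  set A' := levelSpan (k := k) S T y 0 with hA'
  set π := labelProj k β κ (κ q) with hπ
  have hxA : ∀ s ∈ S, x s ∈ A := fun s hs =>
    Submodule.subset_span ⟨s, ⟨hs, hpos' s hs⟩, rfl⟩
  have hyA : ∀ s ∈ S, y s ∈ A' := fun s hs =>
    Submodule.subset_span ⟨s, ⟨hs, hpos s hs⟩, rfl⟩
  have hπy : ∀ s, π (y s) = if κ s = κ q then y s else 0 := fun s => labelProj_chainElt _ _ _
  have hxy : ∀ s, κ s = κ q → x s = y s := fun s hs =>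
    moveElt_of_ne (by rw [hs]; exact hm.ne.symm)
  have hxπ : ∀ s, x s - π (x s) = if κ s = κ q then 0 else y s := by
    intro s
    by_cases hs : κ s = κ q
    · rw [if_pos hs, hxy s hs, hπy, if_pos hs, sub_self]
    -- The modification is a multiple of the generator of `q`, which `π` fixes, while `π` kills `y
    -- s`.
    · have h1 : π (x s) = x s - y s := by
        have h2 : x s = y s + _ := rfl
        conv_lhs => rw [h2]
        rw [map_add, hπy, if_neg hs, zero_add, h2, add_sub_cancel_left]
        split_ifs
        · rw [map_smul, labelProj_basisVec, if_pos rfl]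
        · exact map_zero _
      rw [if_neg hs, h1, sub_sub_cancel]
  have hyπ : ∀ s, y s - π (y s) = if κ s = κ q then 0 else y s := by
    intro s
    rw [hπy]
    split_ifs
    · exact sub_self _
    · exact sub_zero _
  refine NilpEmbedding.extLE_of_idempotent _ π (labelProj_labelProj _) A A' ?_ ?_ ?_ ?_ ?_
  · have : A' ≤ A'.comap π := by
      refine Submodule.span_le.2 ?_
      rintro _ ⟨s, ⟨hs, -⟩, rfl⟩
      change π (y s) ∈ A'
      rw [hπy]
      split_ifs
      · exact hyA s hs
      · exact A'.zero_mem
    exact fun z hz => this hz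
  · have : A ≤ A'.comap (LinearMap.id - π) := by
      refine Submodule.span_le.2 ?_
      rintro _ ⟨s, ⟨hs, -⟩, rfl⟩
      change x s - π (x s) ∈ A'
      rw [hxπ]
      split_ifs
      · exact A'.zero_mem
      · exact hyA s hs
    exact fun z hz => this hz
  · have : A' ≤ (A.map (LinearMap.id - π)).comap (LinearMap.id - π) := by
      refine Submodule.span_le.2 ?_
      rintro _ ⟨s, ⟨hs, -⟩, rfl⟩
      exact ⟨x s, hxA s hs, (hxπ s).trans (hyπ s).symm⟩
    exact fun z hz => this hz
  · have : A' ≤ A.comap π := by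
      refine Submodule.span_le.2 ?_
      rintro _ ⟨s, ⟨hs, -⟩, rfl⟩
      change π (y s) ∈ A
      rw [hπy]
      split_ifs with h
      · rw [← hxy s h]
        exact hxA s hs
      · exact A.zero_mem
    exact fun z hz => this hz
  · intro z hz hπz
    have h1 : z ∈ A.restrictScalars k := hz
    rw [hA, hx.restrictScalars_levelSpan, show {s | s ∈ S ∧ 0 < T' s} = (S : Set ℕ) from
      Set.ext fun s => ⟨fun h => h.1, fun h => ⟨h, hpos' s h⟩⟩] at h1
    obtain ⟨a₀, ha₀⟩ := (Submodule.mem_span_image_finset_iff_exists_fun k).1 h1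
    obtain ⟨a, rfl⟩ : ∃ a : ℕ → k, ∑ s ∈ S, a s • x s = z := by
      refine ⟨fun s => if h : s ∈ S then a₀ ⟨s, h⟩ else 0, ?_⟩
      rw [← ha₀, ← Finset.sum_coe_sort]
      exact Finset.sum_congr rfl fun s _ => congrArg (· • x s) (dif_pos s.2)
    -- Applying `id - π` leaves only the terms outside the chain of `q`. Independence kills their
    -- coefficients, and on the chain of `q` the two families coincide.
    have h2 : ∑ s ∈ S, (if κ s = κ q then 0 else a s) • y s = 0 := by
      have h3 := sub_eq_zero.2 hπz.symm
      rw [map_sum, ← Finset.sum_sub_distrib] at h3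
      rw [← h3]
      refine Finset.sum_congr rfl fun s _ => ?_
      rw [LinearMap.map_smul_of_tower]
      refine Eq.trans ?_ (smul_sub (a s) (x s) (π (x s)))
      rw [hxπ]
      split_ifs
      · exact (zero_smul k (y s)).trans (smul_zero (a s)).symm
      · rfl
    have h4 := linearIndepOn_finset_iff.1 hlin _ h2
    refine Submodule.sum_mem _ fun s hs => ?_
    by_cases h5 : κ s = κ q
    · rw [hxy s h5]
      exact Submodule.smul_of_tower_mem _ _ (hyA s hs)
    · have h6 := h4 s hs
      rw [if_neg h5] at h6
      rw [h6, show (0 : k) • x s = 0 from zero_smul k (x s)]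
      exact A'.zero_mem

/-- Below level `v`, the estimate `b s + (T p - T s) ≤ b p < b q` makes the added term admissible.
On level `v` its exponent can be too large to be compared this way, hence the exclusion. -/
theorem moveElt_sub_mem_remainder {q p v : ℕ} (hm : IsMoveLabel S β.colLen T κ q p v)
    (hpos : ∀ s ∈ S, 0 < T s) {s : ℕ} (hs : s ∈ S) (hsv : κ s = κ p → T s ≠ v) :
    moveElt k β S T κ q (κ p) v (κ s) (T s) -
      (X : k[X]) ^ (β.colLen s - 1) • basisVec k β s ∈ remainder k β (β.colLen s) := by
  rw [moveElt, add_sub_right_comm]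
  refine Submodule.add_mem _ (chainElt_sub_mem_remainder_self hm.chain hpos hs) ?_
  split_ifs with h
  · have h1 := hsv h.1
    have h2 := hm.p_level
    have h3 := hm.chain.add_sub_le hpos _ s p hs hm.p_mem rfl h.1 (by omega)
    have h4 := hm.b_lt
    exact X_pow_smul_basisVec_mem_remainder (by omega) (by omega)
  · exact Submodule.zero_mem _

theorem extLE_of_isIncrease (hst : IsRookStrip β γ) {Δ Γ : LRTableau β γ}
    (h : LRTableau.IsIncrease Δ Γ) : ∃ E F : NilpEmbedding k,
      E.HasShape β γ ∧ F.HasShape β γ ∧ E.HasTableau Δ ∧ F.HasTableau Γ ∧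
        NilpEmbedding.ExtLE E F := by
  obtain ⟨q, hq, hlt, hΔ⟩ := h.exists_colEntry hst.1
  obtain ⟨f, hf⟩ := Γ.exists_isPredMap hst.1
  obtain ⟨f', hf'⟩ := Δ.exists_isPredMap hst.1
  have hpos : ∀ s ∈ skewCols β γ, 0 < Γ.colEntry s := fun s hs => Γ.colEntry_pos hst.1 hs
  have hpos' : ∀ s ∈ skewCols β γ, 0 < Δ.colEntry s := fun s hs => Δ.colEntry_pos hst.1 hs
  obtain ⟨κ, p, hm, hd, hc⟩ := exists_isMoveLabel_increase hpos
    (fun s hs t ht => hst.colLen_lt hs ht) hf hf' hq hlt hΔ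
  have hT : ∀ s ∈ skewCols β γ, Γ.colEntry s ≤ β.colLen s := fun s hs =>
    hm.chain.level_le (fun t ht => by have := hst.1.colLen_eq ht; omega) _ s hs rfl
  set S := skewCols β γ
  set v := Δ.colEntry q with hv
  have hp := hm.p_level
  have hpq := hm.b_lt
  have hvq : v ≤ β.colLen q := by
    have := hT p hm.p_mem
    omega
  have hpne : p ≠ q := fun h => hm.ne (by rw [h])
  -- Since `q` ends its chain and the chain of `p` has no level `v`, both `hxq` and `hxv` produce
  -- the same socle element: the chain of `p` now continues into `q`.
  have hxq : moveElt k β S Γ.colEntry κ q (κ p) v (κ q) (Γ.colEntry q) =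
      (X : k[X]) ^ (β.colLen q - 1) • basisVec k β q := by
    rw [moveElt_of_ne hm.ne.symm, chainElt, Finset.sum_eq_single_of_mem q
      (Finset.mem_filter.2 ⟨hq, rfl, le_rfl⟩), Nat.sub_self, Nat.sub_zero]
    intro t ht htq
    obtain ⟨h1, h2, h3⟩ := Finset.mem_filter.1 ht
    exact absurd (hm.chain.inj t h1 q hq h2 (le_antisymm (hc t h1 h2) h3)) htq
  have hxv : moveElt k β S Γ.colEntry κ q (κ p) v (κ p) v =
      (X : k[X]) ^ (β.colLen q - 1) • basisVec k β q := by
    rw [moveElt, chainElt_eq_zero hd, zero_add, if_pos ⟨rfl, le_rfl⟩, Nat.sub_self, Nat.sub_zero]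
  have hsh : IsShiftFamily k S Δ.colEntry
      (fun s => moveElt k β S Γ.colEntry κ q (κ p) v (κ s) (Γ.colEntry s)) := by
    refine ⟨fun s hs => ?_, fun t ht h1 => ?_⟩
    · rw [X_smul_moveElt hT hvq (hpos s hs)]
      by_cases h : ∃ t ∈ S, κ t = κ s ∧ Γ.colEntry t = Γ.colEntry s + 1
      · obtain ⟨t, ht, h1, h2⟩ := h
        refine Or.inr ⟨t, ht, ?_, by rw [h1, h2]⟩
        have hsq : s ≠ q := by
          rintro rfl
          have := hc t ht h1
          omega
        rw [hΔ s hsq]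
        by_cases htq : t = q
        · rw [htq] at h2 ⊢
          omega
        · rw [hΔ t htq]
          omega
      · have h0 : ∀ t ∈ S, κ t = κ s → Γ.colEntry t < Γ.colEntry s + 1 := by
          intro t ht h1
          by_contra h2
          obtain ⟨t', ht', h3, h4⟩ := hm.chain.exists_level _ (Γ.colEntry s + 1) t ht rfl
            (by omega) (by omega)
          exact h ⟨t', ht', h3.trans h1, h4⟩
        by_cases hκ : κ s = κ p
        · have h1 := hd s hs hκ
          have h2 := h0 p hm.p_mem hκ.symm
          have h3 : Γ.colEntry s + 1 = v := by omega
          -- The end of the chain of `p` is now mapped to `q`, which has level `v` in `Δ`.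
          refine Or.inr ⟨q, hq, ?_, by rw [h3, hκ, hxv, hxq]⟩
          rw [hΔ s fun h4 => hm.ne (by rw [← hκ, h4])]
          omega
        · left
          rw [moveElt_of_ne hκ, chainElt_eq_zero h0]
    · by_cases htq : t = q
      · subst htq
        refine ⟨p, hm.p_mem, by rw [hΔ p hpne, hp], ?_⟩
        rw [X_smul_moveElt hT hvq (hpos p hm.p_mem), hp, hxv, hxq]
      · rw [hΔ t htq] at h1 ⊢
        obtain ⟨s, hs, h2, h3⟩ := hm.chain.pred t ht h1
        refine ⟨s, hs, ?_, ?_⟩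
        · rw [hΔ s ?_, h3]
          rintro rfl
          have := hc t ht h2.symm
          omega
        · rw [X_smul_moveElt hT hvq (hpos s hs), h2, h3]
  have hE : (embedding (levelSpan (k := k) S Δ.colEntry (fun s =>
      moveElt k β S Γ.colEntry κ q (κ p) v (κ s) (Γ.colEntry s)) 0)).HasTableau Δ := by
    refine hasTableau_embedding hst.1 Δ _ _
      (fun s hs => moveElt_sub_mem_remainder hm hpos hs fun h1 => (hd s hs h1).ne)
      (fun e s hs hes => ?_) (fun e => ?_)
    · rw [hsh.X_pow_smul_levelSpan]
      exact Submodule.subset_span ⟨s, ⟨hs, hes⟩, rfl⟩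
    · rw [hsh.X_pow_smul_levelSpan]
      exact hsh.finrank_levelSpan_le e
  have hF := hasTableau_levelSpan (k := k) hst.1 Γ hm.chain
  exact ⟨_, _, hasShape_of_hasTableau hE, hasShape_of_hasTableau hF, hE, hF,
    extLE_levelSpan hm hpos hpos' (linearIndepOn_chainElt hst.1 Γ hm.chain) hsh⟩

theorem extLE_of_isSwap (hst : IsRookStrip β γ) {Δ Γ : LRTableau β γ}
    (h : LRTableau.IsSwap Δ Γ) : ∃ E F : NilpEmbedding k,
      E.HasShape β γ ∧ F.HasShape β γ ∧ E.HasTableau Δ ∧ F.HasTableau Γ ∧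
        NilpEmbedding.ExtLE E F := by
  obtain ⟨q, hq, j, hj, hqj, hlt, hΔ⟩ := h.exists_colEntry hst.1
  obtain ⟨f, hf⟩ := Γ.exists_isPredMap hst.1
  obtain ⟨f', hf'⟩ := Δ.exists_isPredMap hst.1
  have hpos : ∀ s ∈ skewCols β γ, 0 < Γ.colEntry s := fun s hs => Γ.colEntry_pos hst.1 hs
  have hjq : j < q := by
    by_contra hn
    have := β.colLen_anti q j (not_lt.1 hn)
    omega
  obtain ⟨κ, p, hm, hκj, hc⟩ := exists_isMoveLabel_swap hpos
    (fun s hs t ht => hst.colLen_lt hs ht) hf hf' hq hj hjq hlt hΔ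
  have hT : ∀ s ∈ skewCols β γ, Γ.colEntry s ≤ β.colLen s := fun s hs =>
    hm.chain.level_le (fun t ht => by have := hst.1.colLen_eq ht; omega) _ s hs rfl
  set S := skewCols β γ
  set v := Γ.colEntry j with hv
  have hp := hm.p_level
  have hpq := hm.b_lt
  have hvq : v ≤ β.colLen q := by
    have := hT p hm.p_mem
    omega
  set x : ℕ → NilpModule k β :=
    fun s => moveElt k β S Γ.colEntry κ q (κ p) v (κ s) (Γ.colEntry s) with hx
  -- The family keeps the levels of `Γ`; the tableau changes only because other combinations acquire
  -- the leading terms of `q` and `j`.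
  have hsh : IsShiftFamily k S Γ.colEntry x := by
    refine ⟨fun s hs => ?_, fun t ht h1 => ?_⟩
    · simp only [hx]
      rw [X_smul_moveElt hT hvq (hpos s hs)]
      by_cases h : ∃ t ∈ S, κ t = κ s ∧ Γ.colEntry t = Γ.colEntry s + 1
      · obtain ⟨t, ht, h1, h2⟩ := h
        exact Or.inr ⟨t, ht, by omega, by rw [h1, h2]⟩
      · have h0 : ∀ t ∈ S, κ t = κ s → Γ.colEntry t < Γ.colEntry s + 1 := by
          intro t ht h1
          by_contra h2
          obtain ⟨t', ht', h3, h4⟩ := hm.chain.exists_level _ (Γ.colEntry s + 1) t ht rfl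
            (by omega) (by omega)
          exact h ⟨t', ht', h3.trans h1, h4⟩
        left
        -- The chain of `p` contains `j` on level `v`, so its end has level at least `v` and the
        -- added term is gone after one more step.
        rw [moveElt, chainElt_eq_zero h0, zero_add, if_neg]
        rintro ⟨h1, h2⟩
        have := h0 j hj (hκj.trans h1.symm)
        omega
    · obtain ⟨s, hs, h2, h3⟩ := hm.chain.pred t ht h1
      refine ⟨s, hs, h3, ?_⟩
      simp only [hx]
      rw [X_smul_moveElt hT hvq (hpos s hs), h2, h3]
  have hxj : x j = chainElt k β S Γ.colEntry κ (κ j) (Γ.colEntry j) +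
      (X : k[X]) ^ (β.colLen q - 1) • basisVec k β q := by
    simp only [hx]
    rw [moveElt, if_pos ⟨hκj, le_rfl⟩, Nat.sub_self, Nat.sub_zero]
  have hxq : x q = chainElt k β S Γ.colEntry κ (κ q) (Γ.colEntry q) :=
    moveElt_of_ne hm.ne.symm
  -- For `Δ`, the element `x j` of level `v` leads with `q`, as `q` is shorter than `j`. In `x j - x
  -- q` the leading terms of `q` cancel and `j` leads; this difference is only as deep as the lower
  -- level `Γ.colEntry q`.
  have hE : (embedding (levelSpan (k := k) S Γ.colEntry x 0)).HasTableau Δ := by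
    refine hasTableau_embedding hst.1 Δ _
      (fun s => if s = q then x j else if s = j then x j - x q else x s)
      (fun s hs => ?_) (fun e s hs hes => ?_) (fun e => ?_)
    · by_cases hsq : s = q
      · subst hsq
        rw [if_pos rfl, hxj, add_sub_cancel_right]
        refine Submodule.sum_mem _ fun t ht => ?_
        obtain ⟨h1, h2, h3⟩ := Finset.mem_filter.1 ht
        have h4 := hm.chain.add_sub_le hpos _ j t hj h1 rfl h2.symm h3
        exact X_pow_smul_basisVec_mem_remainder (by omega) (by omega)
      · rw [if_neg hsq]
        by_cases hsj : s = j
        · subst hsj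
          have h1 : x s - x q - (X : k[X]) ^ (β.colLen s - 1) • basisVec k β s =
              (chainElt k β S Γ.colEntry κ (κ s) (Γ.colEntry s) -
                (X : k[X]) ^ (β.colLen s - 1) • basisVec k β s) -
              (chainElt k β S Γ.colEntry κ (κ q) (Γ.colEntry q) -
                (X : k[X]) ^ (β.colLen q - 1) • basisVec k β q) := by
            rw [hxj, hxq]
            abel
          rw [if_pos rfl, h1]
          refine Submodule.sub_mem _ (chainElt_sub_mem_remainder_self hm.chain hpos hs)
            (chainElt_sub_mem_remainder hm.chain hq fun t ht h2 h3 => ?_)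
          -- The successor `t'` of `q` is longer than `j`, which makes up for the one level between
          -- `q` and `t'`.
          obtain ⟨t', ht', h4, h5⟩ := hm.chain.exists_level _ (Γ.colEntry q + 1) t ht rfl
            (by omega) (by omega)
          have h6 := hc t' ht' (h4.trans h2) (by omega)
          have h7 := hm.chain.add_sub_le hpos _ t' t ht' ht rfl h4 (by omega)
          omega
        · rw [if_neg hsj]
          exact moveElt_sub_mem_remainder hm hpos hs fun h1 h2 =>
            hsj (hm.chain.inj s hs j hj (h1.trans hκj.symm) h2)
    · rw [hsh.X_pow_smul_levelSpan]
      rw [hΔ] at hes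
      have hmem : ∀ t ∈ S, e < Γ.colEntry t → x t ∈ levelSpan (k := k) S Γ.colEntry x e :=
        fun t ht h1 => Submodule.subset_span ⟨t, ⟨ht, h1⟩, rfl⟩
      by_cases hsq : s = q
      · rw [hsq, Equiv.swap_apply_left] at hes
        rw [if_pos hsq]
        exact hmem j hj hes
      · rw [if_neg hsq]
        by_cases hsj : s = j
        · rw [hsj, Equiv.swap_apply_right] at hes
          rw [if_pos hsj]
          exact Submodule.sub_mem _ (hmem j hj (hes.trans hlt)) (hmem q hq hes)
        · rw [Equiv.swap_apply_of_ne_of_ne hsq hsj] at hes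
          rw [if_neg hsj]
          exact hmem s hs hes
    · rw [hsh.X_pow_smul_levelSpan]
      refine (hsh.finrank_levelSpan_le e).trans (le_of_eq ?_)
      have hS : ∀ s ∈ S, Equiv.swap q j s ∈ S := by
        intro s hs
        rw [Equiv.swap_apply_def]
        split_ifs <;> assumption
      refine Finset.card_nbij' (Equiv.swap q j) (Equiv.swap q j) ?_ ?_ ?_ ?_
      · intro s hs
        have := Finset.mem_filter.1 hs
        refine Finset.mem_filter.2 ⟨hS s this.1, ?_⟩
        rw [hΔ, Equiv.swap_apply_self]
        exact this.2
      · intro s hs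
        have := Finset.mem_filter.1 hs
        refine Finset.mem_filter.2 ⟨hS s this.1, ?_⟩
        rw [← hΔ]
        exact this.2
      · exact fun s _ => Equiv.swap_apply_self q j s
      · exact fun s _ => Equiv.swap_apply_self q j s
  have hF := hasTableau_levelSpan (k := k) hst.1 Γ hm.chain
  exact ⟨_, _, hasShape_of_hasTableau hE, hasShape_of_hasTableau hF, hE, hF,
    extLE_levelSpan hm hpos hpos (linearIndepOn_chainElt hst.1 Γ hm.chain) hsh⟩

end NilpModule

theorem mainTheorem6 (k : Type u) [Field k] (β γ : YoungDiagram)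
    (hrook : YoungDiagram.IsRookStrip β γ) (Δ Γ : LRTableau β γ)
    (h : LRTableau.BoxLE Δ Γ) : LRTableau.ExtLE k Δ Γ := by
  refine Relation.ReflTransGen.mono (fun S T hST => ?_) _ _ h
  rcases hST with hs | hi
  · exact NilpModule.extLE_of_isSwap hrook hs
  · exact NilpModule.extLE_of_isIncrease hrook hi
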